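/- Let $P\in\mathbb C[z]$ be a polynomial of degree $n\ge 1$, let $\Delta$ be the set of its critical values, and let $P_1^{-1},\dots,P_n^{-1}$ be the branches of $P^{-1}$ on a domain $U\subset\mathbb C\setminus\Delta$, numbered so that the permutation in the monodromy group $G_P$ induced by a loop around infinity is the cycle $(1\,2\,\dots\,n)$. For $d\mid n$ let $V_d\subset\mathbb Q^n$ be the space of $d$-periodic vectors, and let $D(G_P)$ be the set of divisors $d$ of $n$ for which $V_d$ is invariant under the permutation representation of $G_P$ on $\mathbb Q^n$. Let $\vec\delta=(v_1,\dots,v_n)\in\mathbb Q^n$, let $\delta(z)=\sum_i v_iP_i^{-1}(z)\in H_0(P^{-1}(z),\mathbb Q)$ be the corresponding cycle, and put $w_r=(1,\varepsilon^r,\varepsilon^{2r},\dots,\varepsilon^{(n-1)r})$, $\varepsilon=e^{2\pi i/n}$. For a decomposition $P=A\circ W$ into polynomials, with $A_k^{-1}$, $1\le k\le \deg A$, the branches of $A^{-1}$ on $U$, the induced cycles are $$\delta_{k,W}=\sum_{i:\ W(P_i^{-1}(z))=A_k^{-1}(z)}v_i\,P_i^{-1}(z)\ \in\ H_0\big(W^{-1}(A_k^{-1}(z)),\mathbb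 Q\big);$$ a cycle is called reduced if the sum of its coefficients is $0$. **Proposition.** Let $Q\in\mathbb C[z]$ be a non-zero polynomial such that $\int_{\delta(z)}Q=\sum_i v_iQ(P_i^{-1}(z))\equiv 0$. Assume that there exist $d_1,\dots,d_l\in D(G_P)$ such that for $1\le r\le n$ one has $(\vec\delta,w_r)=0$ if and only if $r$ is divisible by at least one of the numbers $n/d_1,\dots,n/d_l$. Then $Q$ can be represented in the form $$Q(z)=S_1(W_1(z))+\dots+S_m(W_m(z)),$$ where $S_i$, $W_i$ are polynomials, $P=A_i\circ W_i$ for some polynomials $A_i$, and all the induced cycles $\delta_{k,W_i}$ are reduced. -/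

import Mathlib

open Polynomial

namespace ZeroDimAbelian

/-- The set `Δ` of (finite) critical values of `P`. -/
def criticalValues (P : ℂ[X]) : Set ℂ :=
  {c | ∃ x : ℂ, P.derivative.eval x = 0 ∧ P.eval x = c}

/-- `φ 0, …, φ (n-1)` are the `n` branches of the inverse of `P` (a polynomial of degree `n`) on the
domain `U ⊆ ℂ ∖ Δ`: pairwise distinct holomorphic right inverses of `P`.  The branch `P_i⁻¹` of the
usual numbering by `1, …, n` is `φ (i-1)`. -/
structure IsBranchSystem (P : ℂ[X]) {n : ℕ} (U : Set ℂ) (φ : Fin n → ℂ → ℂ) : Prop where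
  isOpen : IsOpen U
  isConnected : IsConnected U
  notMem_criticalValues : ∀ z ∈ U, z ∉ criticalValues P
  natDegree_eq : P.natDegree = n
  differentiableOn : ∀ i, DifferentiableOn ℂ (φ i) U
  eval_eq : ∀ i, ∀ z ∈ U, P.eval (φ i z) = z
  injective : ∀ z ∈ U, Function.Injective fun i => φ i z

/-- `σ` is the permutation of the (numbered) points `x 0, …, x (n-1)` of the fibre over `z₀` obtained
by lifting the loop `γ` through `P`. -/
def IsMonodromyAlong (P : ℂ[X]) {n : ℕ} (x : Fin n → ℂ) {z₀ : ℂ} (γ : Path z₀ z₀)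
    (σ : Equiv.Perm (Fin n)) : Prop :=
  ∀ i, ∃ lift : Path (x i) (x (σ i)), ∀ t, P.eval (lift t) = γ t

/-- The path (or loop) `γ` stays in `ℂ ∖ Δ`. -/
def AvoidsCriticalValues (P : ℂ[X]) {a b : ℂ} (γ : Path a b) : Prop :=
  ∀ t, γ t ∉ criticalValues P

/-- The monodromy group `G_P` with base point `z₀`, acting on the numbers of the points
`x 0, …, x (n-1)` of the fibre over `z₀`: the permutations given by loops in `ℂ ∖ Δ`. -/
def monodromyGroup (P : ℂ[X]) {n : ℕ} {z₀ : ℂ} (hz₀ : z₀ ∉ criticalValues P)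
    (x : Fin n → ℂ) (hx : ∀ i, P.eval (x i) = z₀) : Subgroup (Equiv.Perm (Fin n)) where
  carrier := {σ | ∃ γ : Path z₀ z₀, AvoidsCriticalValues P γ ∧ IsMonodromyAlong P x γ σ}
  one_mem' := ⟨Path.refl z₀, fun _ => by simpa using hz₀, fun i =>
    ⟨Path.refl (x i), fun _ => hx i⟩⟩
  mul_mem' := by
    rintro σ τ ⟨γ, hγ, hσ⟩ ⟨η, hη, hτ⟩
    refine ⟨η.trans γ, fun t => ?_, fun i => ?_⟩
    · rw [Path.trans_apply]
      split_ifs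
      · exact hη _
      · exact hγ _
    · obtain ⟨a, ha⟩ := hτ i
      obtain ⟨b, hb⟩ := hσ (τ i)
      have key : ∀ t, P.eval ((a.trans b) t) = (η.trans γ) t := by
        intro t
        rw [Path.trans_apply, Path.trans_apply]
        split_ifs
        · exact ha _
        · exact hb _
      exact ⟨a.trans b, key⟩
  inv_mem' := by
    rintro σ ⟨γ, hγ, hσ⟩
    refine ⟨γ.symm, fun t => hγ _, fun i => ?_⟩
    obtain ⟨a, ha⟩ := hσ (σ⁻¹ i)
    refine ⟨a.symm.cast (by simp) rfl, fun t => ?_⟩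
    simpa using ha (unitInterval.symm t)

/-- The circle of radius `R` about the origin, described once counterclockwise from `R`. -/
noncomputable def circlePath (R : ℝ) : Path (R : ℂ) (R : ℂ) where
  toFun t := (R : ℂ) * Complex.exp (2 * Real.pi * Complex.I * ((t : ℝ) : ℂ))
  continuous_toFun := by fun_prop
  source' := by simp
  target' := by simp [Complex.exp_two_pi_mul_I]

/-- `γ` is a loop around infinity based at `z₀`: inside `ℂ ∖ Δ` it runs to a circle that encloses all
critical values, once around this circle, and back along the same way, in one of the two
orientations. -/
def IsLoopAroundInfinity (P : ℂ[X]) {z₀ : ℂ} (γ : Path z₀ z₀) : Prop :=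
  ∃ R : ℝ, 0 < R ∧ (∀ c ∈ criticalValues P, ‖c‖ < R) ∧
    ∃ α : Path z₀ (R : ℂ), AvoidsCriticalValues P α ∧
      (γ = (α.trans (circlePath R)).trans α.symm ∨
        γ = (α.trans (circlePath R).symm).trans α.symm)

/-- The subspace `V_d` of `ℚⁿ` of `d`-periodic vectors (used for `d ∣ n`). -/
def periodicSubspace (n d : ℕ) : Submodule ℚ (Fin n → ℚ) where
  carrier := {v | ∀ i j : Fin n, (i : ℕ) ≡ j [MOD d] → v i = v j}
  add_mem' := by
    intro u v hu hv i j h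
    simp [hu i j h, hv i j h]
  zero_mem' := by
    intro i j _
    rfl
  smul_mem' := by
    intro c v hv i j h
    simp [hv i j h]

/-- `D(G)`: the divisors `d` of `n` for which `V_d` is invariant under the permutation
representation of `G` on `ℚⁿ`. -/
def invariantDivisors {n : ℕ} (G : Subgroup (Equiv.Perm (Fin n))) : Set ℕ :=
  {d | d ∣ n ∧ ∀ σ ∈ G, ∀ v ∈ periodicSubspace n d, (fun i => v (σ⁻¹ i)) ∈ periodicSubspace n d}

/-- The vector `w_k = (1, ε^k, ε^{2k}, …, ε^{(n-1)k})`, `ε = exp (2πi/n)`. -/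
noncomputable def rootVector (n k : ℕ) : Fin n → ℂ :=
  fun j => Complex.exp (2 * Real.pi * Complex.I / n) ^ ((j : ℕ) * k)

/-- The standard Hermitian product of `ℂⁿ`. -/
noncomputable def hermitianProduct {n : ℕ} (u w : Fin n → ℂ) : ℂ :=
  ∑ j, u j * (starRingEnd ℂ) (w j)

/-- The `0`-cycle `δ(z) = ∑ v_i P_i⁻¹(z)` with rational coefficients. -/
noncomputable def cycleAt {n : ℕ} (φ : Fin n → ℂ → ℂ) (δ : Fin n → ℚ) (z : ℂ) : ℂ →₀ ℚ :=
  ∑ i, Finsupp.single (φ i z) (δ i)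

/-- The integral `∫_c Q` of a polynomial over a `0`-cycle: `∑ v_i Q(x_i)` for `c = ∑ v_i x_i`. -/
noncomputable def integralOver (c : ℂ →₀ ℚ) (Q : ℂ[X]) : ℂ :=
  c.sum fun x v => (v : ℂ) * Q.eval x

/-- A `0`-cycle is reduced if the sum of its coefficients is zero. -/
def IsReduced (c : ℂ →₀ ℚ) : Prop :=
  (c.sum fun _ v => v) = 0

open Classical in
/-- The part of the `0`-cycle `c` in the fibre `W⁻¹(w)`.  If `P = A ∘ W`, `c = δ(z)` is a cycle in
`P⁻¹(z)` and `w = A_k⁻¹(z)`, this is the induced cycle `δ_{k,W}` at the point `w`:  it lies in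
`H₀(W⁻¹(w), ℚ)`, and `∫_{δ(z)} Q` is the sum over `w ∈ A⁻¹(z)` of the integrals of `Q` over these
cycles. -/
noncomputable def inducedCycle (W : ℂ[X]) (c : ℂ →₀ ℚ) (w : ℂ) : ℂ →₀ ℚ :=
  c.filter fun x => W.eval x = w

end ZeroDimAbelian

namespace ZeroDimAbelian

open Filter Topology

/-! The relation `∑ v_i Q(P_i⁻¹) = 0` survives analytic continuation along loops. The loop around
infinity shifts the numbering cyclically, so all shifts of the relation hold
(`sum_monodromy_eq_zero`). By the convolution theorem on `ℤ/n` this says `(δ, w_r) · ∑ Q(P_j⁻¹)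
w_r(j) = 0` for every `r`: the Fourier coefficient of `Q` along the fibre vanishes unless some
`n/d_i` divides `r`.

For `d ∈ D(G_P)` the residue classes mod `d` are blocks of the monodromy group. A symmetric function
of the points of a block is therefore single-valued in each of them, holomorphic off a finite set
and of polynomial growth, hence a polynomial (`exists_polynomial_of_growth_off_finset`). Products
over blocks give `W` of degree `n/d`, constant on blocks (`exists_blockProd`); any polynomial
constant on blocks, in particular `P` or a block sum, is a polynomial in `W`
(`exists_comp_of_blockConst`).

Averaging over the blocks mod `d` keeps the Fourier coefficients with `n/d ∣ r` and kills the
others. Subtracting from `Q` such averages for `d_1, …, d_l` in turn (`exists_decomposition`) leaves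
a remainder with no Fourier coefficients at all, so `Q` is a sum of polynomials in the `W_i`.
Finally `(δ, w_r) = 0` for all `r` divisible by `n/d_i` means that `δ` has zero sum on each class
mod `d_i`, which is reducedness of the induced cycles. -/

/-! ### Growth estimates and Liouville-type theorems. -/

theorem norm_eval_le (g : ℂ[X]) : ∃ S : ℝ, 0 ≤ S ∧
    ∀ x, ‖g.eval x‖ ≤ S * (1 + ‖x‖) ^ g.natDegree := by
  refine ⟨∑ i ∈ Finset.range (g.natDegree + 1), ‖g.coeff i‖,
    Finset.sum_nonneg fun _ _ => norm_nonneg _, fun x => ?_⟩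
  rw [eval_eq_sum_range, Finset.sum_mul]
  refine (norm_sum_le _ _).trans (Finset.sum_le_sum fun i hi => ?_)
  rw [norm_mul, norm_pow]
  have h1 : (1 : ℝ) ≤ 1 + ‖x‖ := by linarith [norm_nonneg x]
  have h2 : ‖x‖ ^ i ≤ (1 + ‖x‖) ^ i := by gcongr; linarith
  have h3 : (1 + ‖x‖) ^ i ≤ (1 + ‖x‖) ^ g.natDegree :=
    pow_le_pow_right₀ h1 (by simpa [Nat.lt_succ_iff] using hi)
  gcongr
  exact h2.trans h3

/-- The points of a fibre of a nonconstant polynomial have comparable absolute values. -/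
theorem exists_norm_le_of_eval_eq {P : ℂ[X]} (hP : 1 ≤ P.natDegree) :
    ∃ K : ℝ, 0 ≤ K ∧ ∀ x y, P.eval y = P.eval x → ‖y‖ ≤ K * (1 + ‖x‖) := by
  obtain ⟨S, hS, hSx⟩ := norm_eval_le P
  obtain ⟨T, hT, hTy⟩ := norm_eval_le P.eraseLead
  set n := P.natDegree with hn
  set a := ‖P.leadingCoeff‖ with ha
  have ha0 : 0 < a := by
    rw [ha, norm_pos_iff, leadingCoeff_ne_zero]
    rintro rfl
    simp [hn] at hP
  -- If `‖y‖ > K (1 + ‖x‖)`, then `‖y‖` exceeds both `1` and `1 + ‖x‖`, so comparing leading terms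
  -- and cancelling `‖y‖ ^ (n - 1)` gives `a ‖y‖ ≤ S (1 + ‖x‖) + T 2 ^ n`. This `K` contradicts
  -- that.
  set K : ℝ := 1 + (S + T * 2 ^ n) / a with hK
  have hK1 : 1 ≤ K := by rw [hK]; linarith [show 0 ≤ (S + T * 2 ^ n) / a by positivity]
  refine ⟨K, by linarith, fun x y h => ?_⟩
  by_contra! hlt
  have hx : (1 : ℝ) ≤ 1 + ‖x‖ := by linarith [norm_nonneg x]
  have hy1 : 1 ≤ ‖y‖ := by nlinarith
  have e1 : ‖P.eval y‖ ≤ S * (1 + ‖x‖) ^ n := h ▸ hSx x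
  have e2 : P.eval y = P.eraseLead.eval y + P.leadingCoeff * y ^ n := by
    conv_lhs => rw [← P.eraseLead_add_C_mul_X_pow]
    simp only [eval_add, eval_mul, eval_C, eval_pow, eval_X, hn]
  have e3 : a * ‖y‖ ^ n ≤ S * (1 + ‖x‖) ^ n + T * 2 ^ n * ‖y‖ ^ (n - 1) := by
    have e4 : P.leadingCoeff * y ^ n = P.eval y - P.eraseLead.eval y := by rw [e2]; ring
    have e5 : ‖P.eraseLead.eval y‖ ≤ T * 2 ^ n * ‖y‖ ^ (n - 1) := by
      have hd : P.eraseLead.natDegree ≤ n - 1 := eraseLead_natDegree_le P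
      calc _ ≤ T * (1 + ‖y‖) ^ P.eraseLead.natDegree := hTy y
        _ ≤ T * (2 * ‖y‖) ^ (n - 1) := by
          gcongr T * ?_
          refine (pow_le_pow_right₀ (by linarith) hd).trans ?_
          gcongr; linarith
        _ = T * (2 ^ (n - 1) * ‖y‖ ^ (n - 1)) := by rw [mul_pow]
        _ ≤ T * (2 ^ n * ‖y‖ ^ (n - 1)) := by
          gcongr T * (?_ * _)
          exact pow_le_pow_right₀ (by norm_num) (Nat.sub_le _ _)
        _ = _ := by ring
    calc a * ‖y‖ ^ n = ‖P.eval y - P.eraseLead.eval y‖ := by rw [← e4, norm_mul, norm_pow]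
      _ ≤ ‖P.eval y‖ + ‖P.eraseLead.eval y‖ := norm_sub_le _ _
      _ ≤ _ := by linarith
  have hpow : ‖y‖ ^ n = ‖y‖ ^ (n - 1) * ‖y‖ := by
    rw [← pow_succ, Nat.sub_add_cancel hP]
  have hxpow : (1 + ‖x‖) ^ n ≤ ‖y‖ ^ (n - 1) * (1 + ‖x‖) := by
    conv_lhs => rw [← Nat.sub_add_cancel hP, pow_succ]
    gcongr
    nlinarith
  have hypos : 0 < ‖y‖ ^ (n - 1) := by positivity
  have e6 : a * ‖y‖ ≤ S * (1 + ‖x‖) + T * 2 ^ n := by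
    rw [← mul_le_mul_iff_right₀ hypos]
    rw [hpow] at e3
    nlinarith [mul_le_mul_of_nonneg_left hxpow hS]
  have e7 : a * (K * (1 + ‖x‖)) = a * (1 + ‖x‖) + (S + T * 2 ^ n) * (1 + ‖x‖) := by
    rw [hK]; field_simp
  have e8 : a * (K * (1 + ‖x‖)) < a * ‖y‖ := by gcongr
  have e9 : T * 2 ^ n ≤ T * 2 ^ n * (1 + ‖x‖) := le_mul_of_one_le_right (by positivity) hx
  nlinarith [mul_pos ha0 (show 0 < 1 + ‖x‖ by linarith)]

/-- An entire function of polynomial growth is a polynomial. -/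
theorem exists_polynomial_of_growth {f : ℂ → ℂ} (hf : Differentiable ℂ f) {C : ℝ} {k : ℕ}
    (hC : ∀ x, ‖f x‖ ≤ C * (1 + ‖x‖) ^ k) :
    ∃ p : ℂ[X], p.natDegree ≤ k ∧ ∀ x, f x = p.eval x := by
  -- Cauchy's estimate on circles of radius `R → ∞`.
  have hder : ∀ j, k < j → iteratedDeriv j f 0 = 0 := by
    intro j hj
    have hC0 : 0 ≤ C := by simpa using (norm_nonneg _).trans (hC 0)
    have hb : ∀ R : ℝ, 1 ≤ R → ‖iteratedDeriv j f 0‖ ≤ j.factorial * (C * 2 ^ k) * R⁻¹ := by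
      intro R hR
      have h0 : 0 < R := by linarith
      have := Complex.norm_iteratedDeriv_le_of_forall_mem_sphere_norm_le (c := 0) (f := f) j h0
        hf.diffContOnCl (C := C * (2 * R) ^ k) (fun z hz => by
          refine (hC z).trans ?_
          have : ‖z‖ = R := by simpa using hz
          rw [this]
          gcongr
          linarith)
      refine this.trans ?_
      rw [mul_pow, div_eq_mul_inv]
      have h1 : R ^ k * (R ^ j)⁻¹ ≤ R⁻¹ := by
        rw [← div_eq_mul_inv, div_le_iff₀ (by positivity), inv_mul_eq_div, le_div_iff₀ h0,
          ← pow_succ]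
        exact pow_le_pow_right₀ hR hj
      calc _ = j.factorial * (C * 2 ^ k) * (R ^ k * (R ^ j)⁻¹) := by ring
        _ ≤ _ := by gcongr
    have hlim : Filter.Tendsto (fun R : ℝ => j.factorial * (C * 2 ^ k) * R⁻¹) Filter.atTop
        (nhds 0) := by
      simpa using tendsto_inv_atTop_zero.const_mul (j.factorial * (C * 2 ^ k))
    exact norm_le_zero_iff.1 (ge_of_tendsto hlim
      (Filter.eventually_atTop.2 ⟨1, fun R hR => hb R hR⟩))
  refine ⟨∑ j ∈ Finset.range (k + 1), Polynomial.C ((j.factorial : ℂ)⁻¹ * iteratedDeriv j f 0)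
      * X ^ j, ?_, fun x => ?_⟩
  · refine natDegree_sum_le_of_forall_le _ _ fun j hj => (natDegree_C_mul_X_pow_le _ _).trans ?_
    simpa [Nat.lt_succ_iff] using hj
  · rw [← Complex.taylorSeries_eq_of_entire' 0 x hf, tsum_eq_sum (s := Finset.range (k + 1))]
    · simp [eval_finsetSum]
    · intro j hj
      rw [hder j (by simpa using hj)]
      simp

/-- The complement of a finite set is dense, so the bound extends to all of `ℂ` by continuity. -/
theorem natDegree_le_of_growth {p : ℂ[X]} {s : Finset ℂ} {C : ℝ} {k : ℕ}
    (hC : ∀ x ∉ s, ‖p.eval x‖ ≤ C * (1 + ‖x‖) ^ k) : p.natDegree ≤ k := by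
  have hd : Dense ((s : Set ℂ)ᶜ) := s.countable_toSet.dense_compl ℝ
  have hall : ∀ x, ‖p.eval x‖ ≤ C * (1 + ‖x‖) ^ k := by
    have hcl : IsClosed {x : ℂ | ‖p.eval x‖ ≤ C * (1 + ‖x‖) ^ k} :=
      isClosed_le (by fun_prop) (by fun_prop)
    intro x
    have := hcl.closure_subset_iff.2 (fun x hx => hC x (by simpa using hx)) (hd x)
    exact this
  obtain ⟨q, hq, hpq⟩ := exists_polynomial_of_growth p.differentiable hall
  rwa [Polynomial.funext hpq]

/-- A function that is holomorphic off a finite set and of polynomial growth is a polynomial. -/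
theorem exists_polynomial_of_growth_off_finset {f : ℂ → ℂ} {s : Finset ℂ}
    (hf : ∀ x ∉ s, DifferentiableAt ℂ f x) {C : ℝ} {k : ℕ}
    (hC : ∀ x ∉ s, ‖f x‖ ≤ C * (1 + ‖x‖) ^ k) :
    ∃ p : ℂ[X], p.natDegree ≤ k ∧ ∀ x ∉ s, f x = p.eval x := by
  classical
  -- The growth bound keeps `f` bounded near each point of `s`. Thus `D * f`, extended by `0`, is
  -- continuous, hence entire and a polynomial; it vanishes on `s`, so `D` can be divided out again.
  set D : ℂ[X] := ∏ b ∈ s, (X - Polynomial.C b) with hD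
  have hDz : ∀ x, D.eval x = 0 ↔ x ∈ s := by
    intro x
    simp [hD, eval_prod, Finset.prod_eq_zero_iff, sub_eq_zero]
  set h : ℂ → ℂ := fun x => if x ∈ s then 0 else D.eval x * f x with hh
  have hs : IsClosed (s : Set ℂ) := s.finite_toSet.isClosed
  have hdiff : ∀ x ∉ s, DifferentiableAt ℂ h x := by
    intro x hx
    refine (D.differentiableAt.mul (hf x hx)).congr_of_eventuallyEq ?_
    filter_upwards [hs.isOpen_compl.mem_nhds (by simpa using hx)] with y hy
    have : y ∉ s := by simpa using hy
    simp [hh, this]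
  have hgr : ∀ x, ‖h x‖ ≤ ‖D.eval x‖ * (|C| * (1 + ‖x‖) ^ k) := by
    intro x
    by_cases hx : x ∈ s
    · simp only [hh, hx, if_true, norm_zero]; positivity
    · simp only [hh, hx, if_false, norm_mul]
      gcongr
      exact (hC x hx).trans (by gcongr; exact le_abs_self C)
  have hcont : Continuous h := by
    rw [continuous_iff_continuousAt]
    intro x
    by_cases hx : x ∈ s
    · have h0 : h x = 0 := by simp [hh, hx]
      rw [ContinuousAt, h0]
      refine squeeze_zero_norm hgr ?_
      have hc : Continuous fun x : ℂ => ‖D.eval x‖ * (|C| * (1 + ‖x‖) ^ k) := by fun_prop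
      simpa [(hDz x).2 hx] using hc.tendsto x
    · exact (hdiff x hx).continuousAt
  have hent : Differentiable ℂ h := by
    intro x
    have := Complex.hasFPowerSeriesOnBall_of_differentiable_off_countable (R := 1) (c := x)
      (f := h) s.countable_toSet hcont.continuousOn (fun z hz => hdiff z (by simpa using hz.2))
      one_pos
    exact this.analyticAt.differentiableAt
  obtain ⟨S, hS, hSx⟩ := norm_eval_le D
  obtain ⟨H, -, hH⟩ := exists_polynomial_of_growth hent (C := S * |C|) (k := D.natDegree + k)
    (fun x => (hgr x).trans (by
      calc _ ≤ (S * (1 + ‖x‖) ^ D.natDegree) * (|C| * (1 + ‖x‖) ^ k) := by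
            gcongr; exact hSx x
        _ = _ := by ring))
  have hdvd : D ∣ H := by
    refine Finset.prod_dvd_of_coprime
      (fun a _ b _ hab => isCoprime_X_sub_C_of_isUnit_sub (sub_ne_zero.2 hab).isUnit)
      fun b hb => ?_
    rw [dvd_iff_isRoot, IsRoot, ← hH]
    simp [hh, hb]
  obtain ⟨p, hp⟩ := hdvd
  have hfp : ∀ x ∉ s, f x = p.eval x := by
    intro x hx
    have h1 := hH x
    rw [hp, eval_mul] at h1
    simp only [hh, hx, if_false] at h1
    exact mul_left_cancel₀ (fun h0 => hx ((hDz x).1 h0)) h1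
  exact ⟨p, natDegree_le_of_growth (s := s) fun x hx => hfp x hx ▸ hC x hx, hfp⟩

/-! ### Fibres of `P` and local inverse branches. -/

theorem criticalValues_finite {P : ℂ[X]} (hP : 1 ≤ P.natDegree) : (criticalValues P).Finite := by
  have h0 : P.derivative ≠ 0 := fun h => by
    have := derivative_eq_zero.1 h
    omega
  refine ((P.derivative.roots.toFinset.finite_toSet).image fun x => P.eval x).subset ?_
  rintro c ⟨x, hx, rfl⟩
  exact ⟨x, by simpa [h0] using hx, rfl⟩

/-- An injective enumeration of points in a fibre by the degree exhausts the fibre. -/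
theorem exists_eq_of_eval_eq {P : ℂ[X]} {n : ℕ} (hn : 1 ≤ n) (hP : P.natDegree = n)
    {y : Fin n → ℂ} (hy : Function.Injective y) {z : ℂ} (hyz : ∀ i, P.eval (y i) = z)
    {x : ℂ} (hx : P.eval x = z) : ∃ i, y i = x := by
  classical
  have hdeg : (P - C z).natDegree = n := by rw [natDegree_sub_C, hP]
  have h0 : P - C z ≠ 0 := fun h => by rw [h] at hdeg; simp at hdeg; omega
  have hsub : Finset.univ.image y ⊆ (P - C z).roots.toFinset := by
    intro a ha
    obtain ⟨i, -, rfl⟩ := Finset.mem_image.1 ha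
    simp [h0, hyz i]
  have hcard : (P - C z).roots.toFinset.card ≤ (Finset.univ.image y).card := by
    rw [Finset.card_image_of_injective _ hy, Finset.card_fin, ← hdeg]
    exact (Multiset.toFinset_card_le _).trans (card_roots' _)
  have heq := Finset.eq_of_subset_of_card_le hsub hcard
  have : x ∈ Finset.univ.image y := by
    rw [heq]
    simp [h0, hx]
  simpa using this

/-- Over a noncritical value all roots of `P - z` are simple. -/
theorem exists_fibre {P : ℂ[X]} {n : ℕ} (hn : 1 ≤ n) (hP : P.natDegree = n) {z : ℂ}
    (hz : z ∉ criticalValues P) :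
    ∃ y : Fin n → ℂ, Function.Injective y ∧ ∀ i, P.eval (y i) = z := by
  classical
  have hdeg : (P - C z).natDegree = n := by rw [natDegree_sub_C, hP]
  have h0 : P - C z ≠ 0 := fun h => by rw [h] at hdeg; simp at hdeg; omega
  have hnd : (P - C z).roots.Nodup := by
    rw [Multiset.nodup_iff_count_le_one]
    intro a
    rw [count_roots]
    by_contra! hlt
    have h1 := (one_lt_rootMultiplicity_iff_isRoot h0).1 hlt
    refine hz ⟨a, by simpa using h1.2, ?_⟩
    simpa [sub_eq_zero] using h1.1
  have hcard : (P - C z).roots.toFinset.card = n := by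
    rw [Multiset.toFinset_card_of_nodup hnd, ← hdeg]
    exact (splits_iff_card_roots.1 (IsAlgClosed.splits _))
  let e := ((P - C z).roots.toFinset.equivFinOfCardEq hcard).symm
  refine ⟨fun i => e i, fun i j h => e.injective (Subtype.ext h), fun i => ?_⟩
  have := isRoot_of_mem_roots (Multiset.mem_toFinset.1 (e i).2)
  exact sub_eq_zero.1 (by simpa only [IsRoot, eval_sub, eval_C] using this)

/-- Near a noncritical value there are inverse branches through the points of the fibre. -/
theorem exists_sheets {P : ℂ[X]} {n : ℕ} {z : ℂ} (hz : z ∉ criticalValues P)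
    (hfin : (criticalValues P).Finite) {y : Fin n → ℂ} (hy : Function.Injective y)
    (hyz : ∀ i, P.eval (y i) = z) :
    ∃ r : ℝ, 0 < r ∧ ∃ ψ : Fin n → ℂ → ℂ, (∀ i, ψ i z = y i) ∧
      (∀ w ∈ Metric.ball z r, w ∉ criticalValues P) ∧
      (∀ i, DifferentiableOn ℂ (ψ i) (Metric.ball z r)) ∧
      (∀ i, ∀ w ∈ Metric.ball z r, P.eval (ψ i w) = w) ∧
      ∀ w ∈ Metric.ball z r, Function.Injective fun i => ψ i w := by
  have hd : ∀ i, P.derivative.eval (y i) ≠ 0 := fun i h => hz ⟨y i, h, hyz i⟩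
  have hloc : ∀ i, ∃ ψ : ℂ → ℂ, ψ z = y i ∧ (∀ᶠ w in 𝓝 z, DifferentiableAt ℂ ψ w) ∧
      ∀ᶠ w in 𝓝 z, P.eval (ψ w) = w := by
    intro i
    have hs := P.hasStrictDerivAt (y i)
    have hC : ContDiffAt ℂ 1 (fun x => P.eval x) (y i) := P.differentiable.contDiff.contDiffAt
    have hf := (hs.hasStrictFDerivAt_equiv (hd i)).hasFDerivAt
    refine ⟨hC.localInverse hf one_ne_zero, ?_, ?_, ?_⟩
    · rw [← hyz i]
      exact hC.localInverse_apply_image hf one_ne_zero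
    · have h1 : ContDiffAt ℂ 1 (hC.localInverse hf one_ne_zero) z := by
        have := hC.to_localInverse hf one_ne_zero
        simpa only [hyz i] using this
      filter_upwards [h1.eventually (by simp)] with w hw
      exact hw.differentiableAt one_ne_zero
    · have := (hs.hasStrictFDerivAt_equiv (hd i)).eventually_right_inverse
      rw [hyz i] at this
      exact this
  choose ψ h1 h2 h3 using hloc
  have hinj : ∀ᶠ w in 𝓝 z, ∀ i j, i ≠ j → ψ i w ≠ ψ j w := by
    rw [eventually_all]; intro i
    rw [eventually_all]; intro j
    by_cases hij : i = j
    · simp [hij]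
    · have c1 : ContinuousAt (ψ i) z := (h2 i).self_of_nhds.continuousAt
      have c2 : ContinuousAt (ψ j) z := (h2 j).self_of_nhds.continuousAt
      have hne : ψ i z ≠ ψ j z := by rw [h1, h1]; exact hy.ne hij
      filter_upwards [(c1.sub c2).eventually_ne (sub_ne_zero.2 hne)] with w hw _ using
        sub_ne_zero.1 hw
  have hcrit : ∀ᶠ w in 𝓝 z, w ∉ criticalValues P := hfin.isClosed.isOpen_compl.mem_nhds hz
  obtain ⟨r, hr, hball⟩ := Metric.eventually_nhds_iff_ball.1
    (hcrit.and ((eventually_all.2 h2).and ((eventually_all.2 h3).and hinj)))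
  refine ⟨r, hr, ψ, h1, fun w hw => (hball w hw).1,
    fun i w hw => ((hball w hw).2.1 i).differentiableWithinAt,
    fun i w hw => (hball w hw).2.2.1 i, fun w hw i j hij => ?_⟩
  by_contra hne
  exact (hball w hw).2.2.2 i j hne hij

/-- A continuous lift through `P` that starts on an inverse branch stays on it. -/
theorem eventually_eq_branch {X : Type*} [TopologicalSpace X] {P : ℂ[X]} {n : ℕ} (hn : 1 ≤ n)
    (hP : P.natDegree = n) {B : Set ℂ} (hB : IsOpen B) {ψ : Fin n → ℂ → ℂ}
    (hψ : ∀ i, ContinuousOn (ψ i) B) (hev : ∀ i, ∀ w ∈ B, P.eval (ψ i w) = w)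
    (hinj : ∀ w ∈ B, Function.Injective fun i => ψ i w) {f u : X → ℂ} {a : X}
    (hf : ContinuousAt f a) (hu : ContinuousAt u a) (hfu : ∀ᶠ t in 𝓝 a, P.eval (u t) = f t)
    (ha : f a ∈ B) {k : Fin n} (hk : u a = ψ k (f a)) : ∀ᶠ t in 𝓝 a, u t = ψ k (f t) := by
  -- By continuity the lift stays off the other sheets; as the sheets exhaust the fibre, only sheet
  -- `k` is left.
  have hne : ∀ᶠ t in 𝓝 a, ∀ j, j ≠ k → ψ j (f t) ≠ u t := by
    rw [eventually_all]; intro j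
    by_cases hj : j = k
    · simp [hj]
    · have c1 : ContinuousAt (fun t => ψ j (f t) - u t) a :=
        (((hψ j).continuousAt (hB.mem_nhds ha)).comp hf).sub hu
      have h0 : ψ j (f a) - u a ≠ 0 := by
        rw [hk, sub_ne_zero]
        exact (hinj _ ha).ne hj
      filter_upwards [c1.eventually_ne h0] with t ht _ using sub_ne_zero.1 ht
  filter_upwards [hne, hfu, hf.eventually_mem (hB.mem_nhds ha)] with t ht hft hmem
  obtain ⟨j, hj⟩ := exists_eq_of_eval_eq hn hP (hinj _ hmem) (fun i => hev i _ hmem) hft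
  by_cases hjk : j = k
  · rw [← hj, hjk]
  · exact absurd hj (ht j hjk)

/-! ### Transport of fibre enumerations along paths. -/

/-- `y` enumerates the fibre over `z`, and is obtained from the enumeration `x` of the fibre over
`z₀` by lifting a path in the complement of the critical values. -/
structure IsTransport (P : ℂ[X]) {n : ℕ} (z₀ : ℂ) (x : Fin n → ℂ) (z : ℂ) (y : Fin n → ℂ) :
    Prop where
  injective : Function.Injective y
  eval_eq : ∀ i, P.eval (y i) = z
  exists_path : ∃ γ : Path z₀ z, AvoidsCriticalValues P γ ∧
    ∀ i, ∃ lift : Path (x i) (y i), ∀ t, P.eval (lift t) = γ t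

section Transport

variable {P : ℂ[X]} {n : ℕ} {z₀ : ℂ} {x : Fin n → ℂ}

theorem IsTransport.notMem {z : ℂ} {y : Fin n → ℂ} (h : IsTransport P z₀ x z y) :
    z ∉ criticalValues P := by
  obtain ⟨γ, hγ, -⟩ := h.exists_path
  simpa using hγ 1

theorem IsTransport.refl (hz₀ : z₀ ∉ criticalValues P) (hx : Function.Injective x)
    (hxz : ∀ i, P.eval (x i) = z₀) : IsTransport P z₀ x z₀ x :=
  ⟨hx, hxz, Path.refl z₀, fun _ => hz₀, fun i => ⟨Path.refl _, fun _ => hxz i⟩⟩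

/-- Transport along a path inside a set on which there are inverse branches. -/
theorem IsTransport.along_branches {U : Set ℂ} {ψ : Fin n → ℂ → ℂ}
    (hU : ∀ w ∈ U, w ∉ criticalValues P) (hψ : ∀ i, ContinuousOn (ψ i) U)
    (hP : ∀ i, ∀ w ∈ U, P.eval (ψ i w) = w) (hinj : ∀ w ∈ U, Function.Injective fun i => ψ i w)
    {a b : ℂ} (hab : JoinedIn U a b) (h : IsTransport P z₀ x a fun i => ψ i a) :
    IsTransport P z₀ x b fun i => ψ i b := by
  obtain ⟨β, hβ⟩ := hab
  have hb : b ∈ U := by simpa using hβ 1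
  obtain ⟨γ, hγ, hlift⟩ := h.exists_path
  refine ⟨hinj b hb, fun i => hP i b hb, γ.trans β, fun t => ?_, fun i => ?_⟩
  · rw [Path.trans_apply]
    split_ifs
    · exact hγ _
    · exact hU _ (hβ _)
  · obtain ⟨lift, hl⟩ := hlift i
    have hc : Continuous fun t => ψ i (β t) :=
      continuousOn_univ.1 ((hψ i).comp β.continuous.continuousOn fun t _ => hβ t)
    let η : Path (ψ i a) (ψ i b) := ⟨⟨fun t => ψ i (β t), hc⟩, by simp, by simp⟩
    refine ⟨lift.trans η, fun t => ?_⟩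
    rw [Path.trans_apply, Path.trans_apply]
    split_ifs
    · exact hl _
    · exact hP i _ (hβ _)

/-- Two transports to the same point differ by an element of the monodromy group. -/
theorem IsTransport.exists_perm (hn : 1 ≤ n) (hP : P.natDegree = n)
    (hz₀ : z₀ ∉ criticalValues P) (hx : ∀ i, P.eval (x i) = z₀) {z : ℂ} {y y' : Fin n → ℂ}
    (h : IsTransport P z₀ x z y) (h' : IsTransport P z₀ x z y') :
    ∃ σ ∈ monodromyGroup P hz₀ x hx, ∀ i, y' i = y (σ i) := by
  have hex : ∀ i, ∃ j, y j = y' i := fun i =>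
    exists_eq_of_eval_eq hn hP h.injective h.eval_eq (h'.eval_eq i)
  choose s hs using hex
  have hsinj : Function.Injective s := fun i j hij => h'.injective (by rw [← hs, ← hs, hij])
  let σ : Equiv.Perm (Fin n) := Equiv.ofBijective s (Finite.injective_iff_bijective.1 hsinj)
  refine ⟨σ, ?_, fun i => (hs i).symm⟩
  obtain ⟨γ, hγ, hl⟩ := h.exists_path
  obtain ⟨γ', hγ', hl'⟩ := h'.exists_path
  -- The loop out along `γ'` and back along `γ` lifts from `x i` to `y' i = y (σ i)` and on to `x (σ
  -- i)`.
  refine ⟨γ'.trans γ.symm, fun t => ?_, fun i => ?_⟩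
  · rw [Path.trans_apply]
    split_ifs
    · exact hγ' _
    · exact hγ _
  · obtain ⟨a, ha⟩ := hl' i
    obtain ⟨b, hb⟩ := hl (σ i)
    refine ⟨a.trans (b.symm.cast (hs i).symm rfl), fun t => ?_⟩
    rw [Path.trans_apply, Path.trans_apply]
    split_ifs
    · exact ha _
    · exact hb _

/-- Every noncritical value can be reached by a transport. -/
theorem exists_isTransport (hn : 1 ≤ n) (hP : P.natDegree = n)
    (hz₀ : z₀ ∉ criticalValues P) (hx : Function.Injective x)
    (hxz : ∀ i, P.eval (x i) = z₀) {z : ℂ} (hz : z ∉ criticalValues P) :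
    ∃ y, IsTransport P z₀ x z y := by
  have hfin : (criticalValues P).Finite := criticalValues_finite (hP ▸ hn)
  -- Over a ball with sheets, reachability of one point gives that of all. The reachable set is thus
  -- open and closed in the complement of the critical values, which is connected because that set
  -- is finite.
  have hloc : ∀ a ∉ criticalValues P, ∃ r > 0, ∀ b ∈ Metric.ball a r, ∀ c ∈ Metric.ball a r,
      (∃ y, IsTransport P z₀ x b y) → ∃ y, IsTransport P z₀ x c y := by
    intro a ha
    obtain ⟨y, hy, hya⟩ := exists_fibre hn hP ha
    obtain ⟨r, hr, ψ, -, hcrit, hdiff, hev, hinj⟩ := exists_sheets ha hfin hy hya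
    refine ⟨r, hr, fun b hb c hc ⟨u, hu⟩ => ?_⟩
    have hex : ∀ i, ∃ j, ψ j b = u i := fun i =>
      exists_eq_of_eval_eq hn hP (hinj b hb) (fun j => hev j b hb) (hu.eval_eq i)
    choose s hs using hex
    have hsinj : Function.Injective s := fun i j hij => hu.injective (by rw [← hs, ← hs, hij])
    refine ⟨fun i => ψ (s i) c, IsTransport.along_branches (ψ := fun i => ψ (s i)) hcrit
      (fun i => (hdiff _).continuousOn) (fun i => hev _)
      (fun w hw => (hinj w hw).comp hsinj)
      (((convex_ball a r).isPathConnected ⟨b, hb⟩).joinedIn b hb c hc) ?_⟩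
    simpa only [hs] using hu
  have hconn : IsPreconnected ((criticalValues P)ᶜ) :=
    (hfin.countable.isConnected_compl_of_one_lt_rank (by simp)).isPreconnected
  let A : Set ℂ := {w | w ∉ criticalValues P ∧ ∃ y, IsTransport P z₀ x w y}
  let B : Set ℂ := {w | w ∉ criticalValues P ∧ ¬ ∃ y, IsTransport P z₀ x w y}
  have hopen := hfin.isClosed.isOpen_compl
  have hA : IsOpen A := by
    rw [isOpen_iff_mem_nhds]
    rintro a ⟨ha, hay⟩
    obtain ⟨r, hr, h⟩ := hloc a ha
    filter_upwards [hopen.mem_nhds ha, Metric.ball_mem_nhds a hr] with b hb hb'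
    exact ⟨hb, h a (Metric.mem_ball_self hr) b hb' hay⟩
  have hB : IsOpen B := by
    rw [isOpen_iff_mem_nhds]
    rintro a ⟨ha, hay⟩
    obtain ⟨r, hr, h⟩ := hloc a ha
    filter_upwards [hopen.mem_nhds ha, Metric.ball_mem_nhds a hr] with b hb hb'
    exact ⟨hb, fun hb'' => hay (h b hb' a (Metric.mem_ball_self hr) hb'')⟩
  by_contra hcon
  obtain ⟨w, -, hw⟩ := hconn A B hA hB
    (fun w hw => by
      by_cases h : ∃ y, IsTransport P z₀ x w y
      · exact Or.inl ⟨hw, h⟩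
      · exact Or.inr ⟨hw, h⟩)
    ⟨z₀, hz₀, hz₀, x, IsTransport.refl hz₀ hx hxz⟩ ⟨z, hz, hz, hcon⟩
  exact hw.2.2 hw.1.2

end Transport

theorem exists_finset_preimage_criticalValues {P : ℂ[X]} {n : ℕ} (hn : 1 ≤ n) (hP : P.natDegree = n) :
    ∃ s : Finset ℂ, ∀ a, a ∈ s ↔ P.eval a ∈ criticalValues P := by
  have hfin : ((fun a => P.eval a) ⁻¹' criticalValues P).Finite := by
    refine (criticalValues_finite (hP ▸ hn)).preimage' fun b _ => ?_
    have hne : P ≠ C b := by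
      rintro rfl
      simp at hP
      omega
    rw [preimage_eval_singleton hne]
    exact rootSet_finite ..
  exact ⟨hfin.toFinset, fun a => by simp⟩

/-! ### Residue classes modulo `d` as blocks of the monodromy group. -/

/-- The indices congruent to `i` modulo `d`. -/
def residueClass {n : ℕ} (d : ℕ) (i : Fin n) : Finset (Fin n) :=
  Finset.univ.filter fun j => (j : ℕ) ≡ i [MOD d]

theorem mem_residueClass {n d : ℕ} {i j : Fin n} :
    j ∈ residueClass d i ↔ (j : ℕ) ≡ i [MOD d] := by
  simp [residueClass]

theorem residueClass_eq {n d : ℕ} {i j : Fin n} (h : (i : ℕ) ≡ j [MOD d]) :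
    residueClass d i = residueClass d j := by
  ext k
  rw [mem_residueClass, mem_residueClass]
  exact ⟨fun hk => hk.trans h, fun hk => hk.trans h.symm⟩

/-- The class of `i` is its orbit under adding multiples of `d` in `ℤ/n`; wrapping around is
harmless since `d ∣ n`. Class sums thereby become sums of shifts. -/
theorem sum_residueClass {M : Type*} [AddCommMonoid M] {n d : ℕ} [NeZero n] (hd : d ∣ n)
    (f : Fin n → M) (i : Fin n) :
    ∑ j ∈ residueClass d i, f j = ∑ k ∈ Finset.range (n / d), f (i + Fin.ofNat n (d * k)) := by
  have hn : 0 < n := Nat.pos_of_neZero n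
  have hd0 : 0 < d := Nat.pos_of_dvd_of_pos hd hn
  have hlt : ∀ k ∈ Finset.range (n / d), d * k < n := fun k hk => by
    have := (Nat.lt_div_iff_mul_lt' hd k).1 (Finset.mem_range.1 hk)
    exact this
  symm
  refine Finset.sum_bij (fun k _ => i + Fin.ofNat n (d * k)) ?_ ?_ ?_ (fun _ _ => rfl)
  · intro k hk
    rw [mem_residueClass, Fin.val_add, Fin.val_ofNat, Nat.mod_eq_of_lt (hlt k hk)]
    refine ((Nat.mod_modEq _ n).of_dvd hd).trans ?_
    simp [Nat.ModEq]
  · intro k hk k' hk' h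
    have h1 := congrArg Fin.val (add_left_cancel h)
    rw [Fin.val_ofNat, Fin.val_ofNat, Nat.mod_eq_of_lt (hlt k hk),
      Nat.mod_eq_of_lt (hlt k' hk')] at h1
    exact Nat.eq_of_mul_eq_mul_left hd0 h1
  · intro j hj
    rw [mem_residueClass] at hj
    have hdvd : d ∣ ((j - i : Fin n) : ℕ) := by
      rw [Fin.val_sub, Nat.dvd_mod_iff hd]
      have h1 : (n - i + j) + i ≡ 0 + i [MOD d] := by
        rw [show n - (i : ℕ) + j + i = n + j by omega]
        exact ((Nat.modEq_zero_iff_dvd.2 hd).add hj)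
      exact Nat.modEq_zero_iff_dvd.1 (Nat.ModEq.add_right_cancel' _ h1)
    obtain ⟨k, hk⟩ := hdvd
    refine ⟨k, ?_, ?_⟩
    · rw [Finset.mem_range, Nat.lt_div_iff_mul_lt' hd, ← hk]
      exact (j - i).2
    · rw [← hk]
      simp

theorem card_residueClass {n d : ℕ} (hd : d ∣ n) (i : Fin n) :
    (residueClass d i).card = n / d := by
  have : NeZero n := ⟨fun h => by subst h; exact i.elim0⟩
  have := sum_residueClass hd (fun _ : Fin n => 1) i
  simpa using this

/-- Invariance of `V_d`, tested on the indicator of one residue class, shows that the group permutes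
the classes, so they form a system of imprimitivity. -/
theorem modEq_apply_iff {n d : ℕ} {G : Subgroup (Equiv.Perm (Fin n))}
    (hd : d ∈ invariantDivisors G) {σ : Equiv.Perm (Fin n)} (hσ : σ ∈ G) (i j : Fin n) :
    (σ i : ℕ) ≡ σ j [MOD d] ↔ (i : ℕ) ≡ j [MOD d] := by
  have key : ∀ τ ∈ G, ∀ i j : Fin n, (i : ℕ) ≡ j [MOD d] → (τ i : ℕ) ≡ τ j [MOD d] := by
    intro τ hτ i j hij
    have h1 := hd.2 τ⁻¹ (G.inv_mem hτ) (fun k => if (k : ℕ) ≡ τ i [MOD d] then 1 else 0)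
      (fun a b hab => by
        have : (a : ℕ) ≡ τ i [MOD d] ↔ (b : ℕ) ≡ τ i [MOD d] :=
          ⟨fun h => hab.symm.trans h, fun h => hab.trans h⟩
        simp [this])
    have h2 := h1 i j hij
    by_contra hcon
    have hcon' : ¬ (τ j : ℕ) ≡ τ i [MOD d] := fun h => hcon h.symm
    have hrefl : (τ i : ℕ) ≡ τ i [MOD d] := Nat.ModEq.refl _
    simp [hcon', hrefl] at h2
  refine ⟨fun h => ?_, key σ hσ i j⟩
  simpa using key σ⁻¹ (G.inv_mem hσ) _ _ h

/-! ### Polynomials built from blocks, and decompositions of `P`. -/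

section Block

variable (P : ℂ[X]) {n : ℕ} (z₀ : ℂ) (x : Fin n → ℂ) (d : ℕ)

open Classical in
/-- The block of `a` in its fibre: the points whose index is congruent to that of `a` modulo `d` in
an enumeration transported from `z₀`. -/
noncomputable def block (a : ℂ) : Finset ℂ :=
  if h : ∃ y, IsTransport P z₀ x (P.eval a) y then
    Finset.image h.choose (Finset.univ.filter fun j =>
      ∃ i, h.choose i = a ∧ (j : ℕ) ≡ i [MOD d])
  else ∅

variable {P z₀ x d}

theorem eval_eq_of_mem_block {a b : ℂ} (h : b ∈ block P z₀ x d a) : P.eval b = P.eval a := by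
  classical
  unfold block at h
  split_ifs at h with hex
  · obtain ⟨j, -, rfl⟩ := Finset.mem_image.1 h
    exact hex.choose_spec.eval_eq j
  · simp at h

variable (hn : 1 ≤ n) (hP : P.natDegree = n) (hz₀ : z₀ ∉ criticalValues P)
  (hx : Function.Injective x) (hxz : ∀ i, P.eval (x i) = z₀)
  (hd : d ∈ invariantDivisors (monodromyGroup P hz₀ x hxz))

include hn hP hd

-- The block does not depend on the chosen transport: two choices differ by a monodromy element,
-- which permutes the residue classes.
open Classical in
theorem block_eq {z : ℂ} {y : Fin n → ℂ} (h : IsTransport P z₀ x z y) (i : Fin n) :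
    block P z₀ x d (y i) = (residueClass d i).image y := by
  have hz : P.eval (y i) = z := h.eval_eq i
  have hex : ∃ y', IsTransport P z₀ x (P.eval (y i)) y' := ⟨y, hz.symm ▸ h⟩
  rw [block, dif_pos hex]
  have hspec := hex.choose_spec
  set y' := hex.choose
  rw [hz] at hspec
  obtain ⟨σ, hσ, hσy⟩ := IsTransport.exists_perm hn hP hz₀ hxz h hspec
  ext b
  simp only [Finset.mem_image, Finset.mem_filter, Finset.mem_univ, true_and, mem_residueClass]
  constructor
  · rintro ⟨j, ⟨k, hk, hjk⟩, rfl⟩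
    refine ⟨σ j, ?_, (hσy j).symm⟩
    have : σ k = i := h.injective (by rw [← hσy, hk])
    rw [← this, modEq_apply_iff hd hσ]
    exact hjk
  · rintro ⟨j, hj, rfl⟩
    refine ⟨σ.symm j, ⟨σ.symm i, by simp [hσy], ?_⟩, by simp [hσy]⟩
    rw [← modEq_apply_iff hd hσ]
    simpa using hj

include hx

open Classical in
/-- Near a noncritical point the blocks are described by inverse branches. -/
theorem exists_local_block {a : ℂ} (ha : P.eval a ∉ criticalValues P) :
    ∃ (c : Finset (Fin n)) (ψ : Fin n → ℂ → ℂ), (∀ i, DifferentiableAt ℂ (ψ i) (P.eval a)) ∧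
      ∀ᶠ b in 𝓝 a, (Function.Injective fun i => ψ i (P.eval b)) ∧
        block P z₀ x d b = c.image fun i => ψ i (P.eval b) := by
  have hfin : (criticalValues P).Finite := criticalValues_finite (hP ▸ hn)
  obtain ⟨y, hy⟩ := exists_isTransport hn hP hz₀ hx hxz ha
  obtain ⟨i, hi⟩ := exists_eq_of_eval_eq hn hP hy.injective hy.eval_eq rfl
  obtain ⟨r, hr, ψ, hψ, hcrit, hdiff, hev, hinj⟩ :=
    exists_sheets ha hfin hy.injective hy.eval_eq
  have hda : ∀ i, DifferentiableAt ℂ (ψ i) (P.eval a) := fun i =>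
    (hdiff i).differentiableAt (Metric.ball_mem_nhds _ hr)
  refine ⟨residueClass d i, ψ, hda, ?_⟩
  have hball : ∀ᶠ b in 𝓝 a, P.eval b ∈ Metric.ball (P.eval a) r :=
    P.continuous.continuousAt.eventually_mem (Metric.ball_mem_nhds _ hr)
  -- The identity map is a continuous lift of `P` through `P`, so near `a` it follows the sheet
  -- through `a`.
  have hbranch : ∀ᶠ b in 𝓝 a, b = ψ i (P.eval b) :=
    eventually_eq_branch (u := fun b => b) hn hP Metric.isOpen_ball
      (fun i => (hdiff i).continuousOn) hev hinj P.continuous.continuousAt continuousAt_id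
      (.of_forall fun _ => rfl) (Metric.mem_ball_self hr) (by rw [hψ, hi])
  filter_upwards [hball, hbranch] with b hb hbi
  refine ⟨hinj _ hb, ?_⟩
  have ht : IsTransport P z₀ x (P.eval b) fun i => ψ i (P.eval b) :=
    IsTransport.along_branches hcrit (fun i => (hdiff i).continuousOn) hev hinj
      (((convex_ball (P.eval a) r).isPathConnected
        ⟨_, hb⟩).joinedIn _ (Metric.mem_ball_self hr) _ hb)
      (by simpa only [hψ] using hy)
  have := block_eq hn hP hz₀ hxz hd ht i
  rwa [← hbi] at this

theorem card_block {a : ℂ} (ha : P.eval a ∉ criticalValues P) :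
    (block P z₀ x d a).card = n / d := by
  classical
  obtain ⟨y, hy⟩ := exists_isTransport hn hP hz₀ hx hxz ha
  obtain ⟨i, rfl⟩ := exists_eq_of_eval_eq hn hP hy.injective hy.eval_eq rfl
  rw [block_eq hn hP hz₀ hxz hd hy, Finset.card_image_of_injective _ hy.injective,
    card_residueClass hd.1]

/-- The sum of the values of a polynomial over the blocks is given by a polynomial. -/
theorem exists_blockSum (g : ℂ[X]) : ∃ p : ℂ[X], ∀ z y, IsTransport P z₀ x z y → ∀ i,
    p.eval (y i) = ∑ j ∈ residueClass d i, g.eval (y j) := by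
  classical
  obtain ⟨s, hs⟩ := exists_finset_preimage_criticalValues (P := P) hn hP
  obtain ⟨K, hK, hKb⟩ := exists_norm_le_of_eval_eq (P := P) (hP ▸ hn)
  obtain ⟨S, hS, hSg⟩ := norm_eval_le g
  -- The constant: a block has `n / d` points `b`, each with `1 + ‖b‖ ≤ (1 + K) (1 + ‖a‖)`.
  obtain ⟨p, -, hp⟩ := exists_polynomial_of_growth_off_finset (s := s)
    (f := fun a => ∑ b ∈ block P z₀ x d a, g.eval b)
    (C := (n / d : ℕ) * (S * (1 + K) ^ g.natDegree)) (k := g.natDegree)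
    (fun a ha => by
      obtain ⟨c, ψ, hψ, hloc⟩ := exists_local_block hn hP hz₀ hx hxz hd
        (fun h => ha ((hs a).2 h))
      have hdiff : DifferentiableAt ℂ (fun b => ∑ i ∈ c, g.eval (ψ i (P.eval b))) a :=
        DifferentiableAt.fun_sum fun i _ =>
          g.differentiableAt.comp a ((hψ i).comp a P.differentiableAt)
      refine hdiff.congr_of_eventuallyEq ?_
      filter_upwards [hloc] with b hb
      rw [hb.2, Finset.sum_image hb.1.injOn])
    (fun a ha => by
      have hcard := card_block hn hP hz₀ hx hxz hd (fun h => ha ((hs a).2 h))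
      rw [← hcard, mul_assoc, ← nsmul_eq_mul]
      refine (norm_sum_le _ _).trans (Finset.sum_le_card_nsmul _ _ _ fun b hb => ?_)
      have h1 := hKb a b (eval_eq_of_mem_block hb)
      refine (hSg b).trans ?_
      rw [mul_assoc, ← mul_pow]
      gcongr
      nlinarith [norm_nonneg a])
  refine ⟨p, fun z y hy i => ?_⟩
  rw [← hp (y i) (fun h => hy.notMem (hy.eval_eq i ▸ (hs _).1 h)),
    block_eq hn hP hz₀ hxz hd hy, Finset.sum_image hy.injective.injOn]

/-- There is a polynomial of degree `n / d` that is constant on the blocks. -/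
theorem exists_blockProd : ∃ W : ℂ[X], W.natDegree = n / d ∧
    ∀ z y, IsTransport P z₀ x z y → ∀ i j : Fin n, (i : ℕ) ≡ j [MOD d] →
      W.eval (y i) = W.eval (y j) := by
  classical
  obtain ⟨s, hs⟩ := exists_finset_preimage_criticalValues (P := P) hn hP
  obtain ⟨K, hK, hKb⟩ := exists_norm_le_of_eval_eq (P := P) (hP ▸ hn)
  let i₀ : Fin n := ⟨0, hn⟩
  -- Subtracting `x i₀` makes `W` vanish on the block of `x i₀`. Those `n / d` roots bound the
  -- degree below, while the growth exponent bounds it above.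
  obtain ⟨W, hWdeg, hW⟩ := exists_polynomial_of_growth_off_finset (s := s)
    (f := fun a => ∏ b ∈ block P z₀ x d a, (b - x i₀))
    (C := (K + ‖x i₀‖) ^ (n / d)) (k := n / d)
    (fun a ha => by
      obtain ⟨c, ψ, hψ, hloc⟩ := exists_local_block hn hP hz₀ hx hxz hd
        (fun h => ha ((hs a).2 h))
      have hdiff : DifferentiableAt ℂ (fun b => ∏ i ∈ c, (ψ i (P.eval b) - x i₀)) a :=
        DifferentiableAt.fun_finsetProd fun i _ =>
          ((hψ i).comp a P.differentiableAt).sub_const _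
      refine hdiff.congr_of_eventuallyEq ?_
      filter_upwards [hloc] with b hb
      rw [hb.2, Finset.prod_image hb.1.injOn])
    (fun a ha => by
      have hcard := card_block hn hP hz₀ hx hxz hd (fun h => ha ((hs a).2 h))
      rw [← mul_pow, norm_prod, ← hcard]
      rw [← Finset.prod_const]
      refine Finset.prod_le_prod (fun _ _ => norm_nonneg _) fun b hb => ?_
      have h1 := hKb a b (eval_eq_of_mem_block hb)
      have h2 : ‖b - x i₀‖ ≤ ‖b‖ + ‖x i₀‖ := norm_sub_le _ _
      nlinarith [norm_nonneg a, norm_nonneg (x i₀), mul_nonneg (norm_nonneg (x i₀)) (norm_nonneg a)])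
  have hval : ∀ z y, IsTransport P z₀ x z y → ∀ i,
      W.eval (y i) = ∏ j ∈ residueClass d i, (y j - x i₀) := by
    intro z y hy i
    rw [← hW (y i) (fun h => hy.notMem (hy.eval_eq i ▸ (hs _).1 h)),
      block_eq hn hP hz₀ hxz hd hy, Finset.prod_image hy.injective.injOn]
  have hconst : ∀ z y, IsTransport P z₀ x z y → ∀ i j : Fin n, (i : ℕ) ≡ j [MOD d] →
      W.eval (y i) = W.eval (y j) := fun z y hy i j hij => by
    rw [hval z y hy, hval z y hy, residueClass_eq hij]
  refine ⟨W, le_antisymm hWdeg ?_, hconst⟩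
  have hrefl : IsTransport P z₀ x z₀ x := IsTransport.refl hz₀ hx hxz
  -- Over a point other than `z₀` no factor of the product vanishes.
  have hW0 : W ≠ 0 := by
    rintro rfl
    obtain ⟨z, hz⟩ := ((criticalValues_finite (P := P) (hP ▸ hn)).insert z₀).infinite_compl.nonempty
    have hz' : z ≠ z₀ ∧ z ∉ criticalValues P := by simpa using hz
    obtain ⟨y, hy⟩ := exists_isTransport hn hP hz₀ hx hxz hz'.2
    have := hval z y hy i₀
    rw [eval_zero, eq_comm, Finset.prod_eq_zero_iff] at this
    obtain ⟨j, -, hj⟩ := this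
    refine hz'.1 ?_
    rw [← hy.eval_eq j, sub_eq_zero.1 hj, hxz]
  have hroot : (residueClass d i₀).image x ⊆ W.roots.toFinset := by
    intro a ha
    obtain ⟨j, hj, rfl⟩ := Finset.mem_image.1 ha
    have : W.eval (x j) = 0 := by
      rw [hval z₀ x hrefl, Finset.prod_eq_zero_iff]
      exact ⟨i₀, mem_residueClass.2 (mem_residueClass.1 hj).symm, sub_self _⟩
    simpa [hW0] using this
  have := Finset.card_le_card hroot
  rw [Finset.card_image_of_injective _ hx, card_residueClass hd.1] at this
  exact this.trans ((Multiset.toFinset_card_le _).trans (card_roots' _))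

/-- A polynomial that is constant on almost all blocks is a polynomial in `W`. -/
theorem exists_comp_of_blockConst {W : ℂ[X]} (hW : W.natDegree = n / d)
    (hWc : ∀ z y, IsTransport P z₀ x z y → ∀ i j : Fin n, (i : ℕ) ≡ j [MOD d] →
      W.eval (y i) = W.eval (y j)) {g : ℂ[X]} {s : Set ℂ} (hs : s.Finite)
    (hg : ∀ z ∉ s, ∀ y, IsTransport P z₀ x z y → ∀ i j : Fin n, (i : ℕ) ≡ j [MOD d] →
      g.eval (y i) = g.eval (y j)) : ∃ S : ℂ[X], g = S.comp W := by
  classical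
  -- On one block, `D = ∏ (X - y_j)` divides `g - const`, and equals `W - w` up to a scalar by
  -- degree. So `g - const = (W - w) * h` with `h` of smaller degree and again constant on blocks
  -- wherever `W - w` can be cancelled. The exceptional set `s` absorbs the fibres where it cannot.
  induction hN : g.natDegree using Nat.strong_induction_on generalizing g s with
  | _ N ih =>
  by_cases hN0 : N = 0
  · refine ⟨C (g.coeff 0), ?_⟩
    rw [C_comp]
    exact eq_C_of_natDegree_eq_zero (hN.trans hN0)
  have hdpos : 0 < d := Nat.pos_of_dvd_of_pos hd.1 hn
  have hm : 0 < n / d := Nat.div_pos (Nat.le_of_dvd hn hd.1) hdpos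
  obtain ⟨z, hz⟩ := ((criticalValues_finite (P := P) (hP ▸ hn)).union hs).infinite_compl.nonempty
  have hz' : z ∉ criticalValues P ∧ z ∉ s := by simpa using hz
  obtain ⟨y, hy⟩ := exists_isTransport hn hP hz₀ hx hxz hz'.1
  let i₀ : Fin n := ⟨0, hn⟩
  set w := W.eval (y i₀) with hw
  set D : ℂ[X] := ∏ j ∈ residueClass d i₀, (X - C (y j)) with hD
  have hDdvd : ∀ f : ℂ[X], (∀ i j : Fin n, (i : ℕ) ≡ j [MOD d] → f.eval (y i) = f.eval (y j)) →
      D ∣ f - C (f.eval (y i₀)) := by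
    intro f hf
    refine Finset.prod_dvd_of_coprime
      (fun a _ b _ hab => isCoprime_X_sub_C_of_isUnit_sub
        (sub_ne_zero.2 (hy.injective.ne hab)).isUnit) fun j hj => ?_
    rw [dvd_iff_isRoot, IsRoot, eval_sub, eval_C, sub_eq_zero]
    exact hf _ _ (mem_residueClass.1 hj)
  have hDdeg : D.natDegree = n / d := by
    rw [hD, natDegree_finsetProd_X_sub_C_eq_card, card_residueClass hd.1]
  obtain ⟨k, hk⟩ := hDdvd W (hWc z y hy)
  obtain ⟨q, hq⟩ := hDdvd g (hg z hz'.2 y hy)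
  rw [← hw] at hk
  have hWw : (W - C w).natDegree = n / d := by rw [natDegree_sub_C, hW]
  have hWw0 : W - C w ≠ 0 := fun h => by rw [h, natDegree_zero] at hWw; omega
  have hDk : D ≠ 0 ∧ k ≠ 0 := by
    rw [hk] at hWw0
    exact ⟨left_ne_zero_of_mul hWw0, right_ne_zero_of_mul hWw0⟩
  have hkdeg : k.natDegree = 0 := by
    rw [hk, natDegree_mul hDk.1 hDk.2, hDdeg] at hWw
    omega
  obtain ⟨c, rfl⟩ : ∃ c, k = C c := ⟨_, eq_C_of_natDegree_eq_zero hkdeg⟩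
  have hc : c ≠ 0 := fun h => hDk.2 (by rw [h, C_0])
  set h : ℂ[X] := C c⁻¹ * q with hh
  have hgh : g - C (g.eval (y i₀)) = (W - C w) * h := by
    rw [hq, hk, hh]
    have : (C c * C c⁻¹ : ℂ[X]) = 1 := by rw [← C_mul, mul_inv_cancel₀ hc, C_1]
    linear_combination (-(D * q)) * this
  have hgdeg : (g - C (g.eval (y i₀))).natDegree = N := by rw [natDegree_sub_C, hN]
  have hh0 : h ≠ 0 := by
    rintro h0
    rw [hgh, h0, mul_zero, natDegree_zero] at hgdeg
    exact hN0 hgdeg.symm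
  have hhdeg : h.natDegree < N := by
    rw [hgh, natDegree_mul hWw0 hh0, hWw] at hgdeg
    omega
  obtain ⟨S, hS⟩ := ih _ hhdeg (g := h)
    (s := s ∪ (fun a => P.eval a) '' ((W - C w).roots.toFinset : Set ℂ))
    (hs.union ((Finset.finite_toSet _).image _))
    (fun z' hz' y' hy' i j hij => by
      rw [Set.mem_union, not_or] at hz'
      have hne : ∀ i, W.eval (y' i) - w ≠ 0 := fun i h0 =>
        hz'.2 ⟨y' i, by simpa [hWw0] using h0, hy'.eval_eq i⟩
      have e : ∀ i, g.eval (y' i) - g.eval (y i₀) = (W.eval (y' i) - w) * h.eval (y' i) :=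
        fun i => by simpa using congrArg (eval (y' i)) hgh
      have e1 := e i
      rw [hWc z' y' hy' i j hij, hg z' hz'.1 y' hy' i j hij, e j] at e1
      exact (mul_left_cancel₀ (hne j) e1).symm)
    rfl
  refine ⟨(X - C w) * S + C (g.eval (y i₀)), ?_⟩
  rw [add_comp, mul_comp, sub_comp, X_comp, C_comp, C_comp, ← hS, ← hgh]
  ring

end Block

/-! ### Fourier analysis on `ℤ/n`. -/

section Fourier

variable {n : ℕ} [NeZero n]

theorem exp_pow_eq_one : Complex.exp (2 * Real.pi * Complex.I / n) ^ n = 1 :=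
  (Complex.isPrimitiveRoot_exp n (NeZero.ne n)).pow_eq_one

theorem rootVector_ofNat (r a : ℕ) :
    rootVector n r (Fin.ofNat n a) = Complex.exp (2 * Real.pi * Complex.I / n) ^ (a * r) := by
  rw [rootVector, pow_mul, pow_mul, Fin.val_ofNat, ← pow_eq_pow_mod a exp_pow_eq_one]

theorem rootVector_add (r : ℕ) (i j : Fin n) :
    rootVector n r (i + j) = rootVector n r i * rootVector n r j := by
  simp only [rootVector]
  rw [pow_mul, Fin.val_add, ← pow_eq_pow_mod _ exp_pow_eq_one, ← pow_mul, add_mul, pow_add]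

theorem conj_rootVector_mul (r : ℕ) (i : Fin n) :
    (starRingEnd ℂ) (rootVector n r i) * rootVector n r i = 1 := by
  have h1 : ‖Complex.exp (2 * Real.pi * Complex.I / n)‖ = 1 :=
    Complex.norm_eq_one_of_pow_eq_one exp_pow_eq_one (NeZero.ne n)
  rw [Complex.conj_mul', rootVector, norm_pow, h1]
  simp

theorem rootVector_ofNat_eq_one_iff {d : ℕ} (hd : d ∣ n) (r : ℕ) :
    rootVector n r (Fin.ofNat n d) = 1 ↔ n / d ∣ r := by
  rw [rootVector_ofNat, (Complex.isPrimitiveRoot_exp n (NeZero.ne n)).pow_eq_one_iff_dvd]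
  obtain ⟨m, hm⟩ := hd
  have hd0 : 0 < d := Nat.pos_of_ne_zero fun h => NeZero.ne n (by rw [hm, h, zero_mul])
  rw [hm, Nat.mul_div_cancel_left _ hd0, Nat.mul_dvd_mul_iff_left hd0]

theorem rootVector_ofNat_mul {d r : ℕ} (hd : d ∣ n) (hr : n / d ∣ r) (k : ℕ) :
    rootVector n r (Fin.ofNat n (d * k)) = 1 := by
  have := (rootVector_ofNat_eq_one_iff hd r).2 hr
  rw [rootVector_ofNat] at this ⊢
  rw [show d * k * r = d * r * k by ring, pow_mul, this, one_pow]

/-- A vector all of whose Fourier coefficients vanish is zero. -/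
theorem eq_zero_of_sum_mul_rootVector {q : Fin n → ℂ}
    (h : ∀ r, 1 ≤ r → r ≤ n → ∑ i, q i * rootVector n r i = 0) : q = 0 := by
  have hε := Complex.isPrimitiveRoot_exp n (NeZero.ne n)
  refine Matrix.eq_zero_of_forall_index_sum_mul_pow_eq_zero
    (f := fun j : Fin n => Complex.exp (2 * Real.pi * Complex.I / n) ^ (j : ℕ))
    (fun i j hij => Fin.ext (hε.pow_inj i.2 j.2 hij)) fun j => ?_
  -- The hypothesis runs over `1 ≤ r ≤ n`, so the trivial character, Vandermonde exponent `0`, is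
  -- found at `r = n`.
  by_cases hj : (j : ℕ) = 0
  · rw [← h n (Nat.pos_of_neZero n) le_rfl]
    refine Finset.sum_congr rfl fun i _ => ?_
    rw [rootVector, mul_comm (i : ℕ) n, pow_mul, exp_pow_eq_one, hj]
    simp
  · rw [← h j (Nat.pos_of_ne_zero hj) j.2.le]
    refine Finset.sum_congr rfl fun i _ => ?_
    rw [rootVector, ← pow_mul, mul_comm (i : ℕ)]

/-- `w_r` is a unitary character of `ℤ/n`, so a shift multiplies the Fourier coefficient by its
conjugate value. -/
theorem sum_shift_mul_rootVector (q : Fin n → ℂ) (r : ℕ) (s : Fin n) :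
    ∑ i, q (i + s) * rootVector n r i =
      (starRingEnd ℂ) (rootVector n r s) * ∑ i, q i * rootVector n r i := by
  rw [← Equiv.sum_comp (Equiv.addRight s) fun i => q i * rootVector n r i, Finset.mul_sum]
  refine Finset.sum_congr rfl fun i _ => ?_
  rw [Equiv.coe_addRight, rootVector_add]
  linear_combination (-(q (i + s) * rootVector n r i)) * conj_rootVector_mul r s

/-- Convolution theorem: the left side is the Fourier transform in `s` of the correlations that are
assumed to vanish. -/
theorem hermitianProduct_mul_sum_eq_zero {v q : Fin n → ℂ}
    (h : ∀ s, ∑ i, v i * q (i + s) = 0) (r : ℕ) :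
    hermitianProduct v (rootVector n r) * ∑ i, q i * rootVector n r i = 0 := by
  have h1 : ∑ s, (∑ i, v i * q (i + s)) * rootVector n r s = 0 := by simp [h]
  rw [← h1, hermitianProduct, Finset.sum_mul]
  simp_rw [Finset.sum_mul]
  rw [Finset.sum_comm]
  refine Finset.sum_congr rfl fun i _ => ?_
  rw [mul_assoc, ← sum_shift_mul_rootVector, Finset.mul_sum]
  refine Finset.sum_congr rfl fun s _ => ?_
  rw [add_comm s i]
  ring

theorem sum_residueClass_mul_rootVector {d : ℕ} (hd : d ∣ n) (q : Fin n → ℂ) (r : ℕ) :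
    ∑ i, (∑ j ∈ residueClass d i, q j) * rootVector n r i =
      (∑ k ∈ Finset.range (n / d), (starRingEnd ℂ) (rootVector n r (Fin.ofNat n (d * k)))) *
        ∑ i, q i * rootVector n r i := by
  rw [Finset.sum_mul]
  simp_rw [← sum_shift_mul_rootVector]
  rw [Finset.sum_comm]
  refine Finset.sum_congr rfl fun i _ => ?_
  rw [sum_residueClass hd, Finset.sum_mul]

theorem sum_residueClass_mul_rootVector_of_dvd {d r : ℕ} (hd : d ∣ n) (hr : n / d ∣ r)
    (q : Fin n → ℂ) : ∑ i, (∑ j ∈ residueClass d i, q j) * rootVector n r i =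
      (n / d : ℕ) * ∑ i, q i * rootVector n r i := by
  rw [sum_residueClass_mul_rootVector hd]
  congr 1
  rw [Finset.sum_congr rfl fun k _ => by rw [rootVector_ofNat_mul hd hr, map_one]]
  simp

/-- Class sums are unchanged under the shift by `d`, whereas that shift multiplies this coefficient
by a number other than `1`. -/
theorem sum_residueClass_mul_rootVector_of_not_dvd {d r : ℕ} (hd : d ∣ n) (hr : ¬ n / d ∣ r)
    (q : Fin n → ℂ) : ∑ i, (∑ j ∈ residueClass d i, q j) * rootVector n r i = 0 := by
  have h := sum_shift_mul_rootVector (fun i => ∑ j ∈ residueClass d i, q j) r (Fin.ofNat n d)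
  have hper : ∀ i : Fin n, residueClass d (i + Fin.ofNat n d) = residueClass d i := fun i => by
    refine residueClass_eq ?_
    rw [Fin.val_add, Fin.val_ofNat]
    refine ((Nat.mod_modEq _ n).of_dvd hd).trans ?_
    have h1 : d % n ≡ 0 [MOD d] := ((Nat.mod_modEq d n).of_dvd hd).trans (by simp [Nat.ModEq])
    exact (Nat.ModEq.refl (i : ℕ)).add h1
  simp only [hper] at h
  have hne : (starRingEnd ℂ) (rootVector n r (Fin.ofNat n d)) ≠ 1 := fun h1 =>
    hr ((rootVector_ofNat_eq_one_iff hd r).1 (by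
      have := conj_rootVector_mul r (Fin.ofNat n d)
      rwa [h1, one_mul] at this))
  have h2 : (1 - (starRingEnd ℂ) (rootVector n r (Fin.ofNat n d))) *
      ∑ i, (∑ j ∈ residueClass d i, q j) * rootVector n r i = 0 := by
    linear_combination h
  exact (mul_eq_zero.1 h2).resolve_left (sub_ne_zero.2 hne.symm)

/-- If a rational vector is orthogonal to all `w_r` with `n / d ∣ r`, its sums over the residue
classes modulo `d` vanish. -/
theorem sum_residueClass_eq_zero {d : ℕ} (hd : d ∣ n) {v : Fin n → ℚ}
    (h : ∀ r, 1 ≤ r → r ≤ n → n / d ∣ r →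
      hermitianProduct (fun j => (v j : ℂ)) (rootVector n r) = 0) (i : Fin n) :
    ∑ j ∈ residueClass d i, v j = 0 := by
  have h0 : (fun i : Fin n => ∑ j ∈ residueClass d i, (v j : ℂ)) = 0 := by
    refine eq_zero_of_sum_mul_rootVector fun r hr hrn => ?_
    by_cases hdr : n / d ∣ r
    · have h1 := congrArg (starRingEnd ℂ) (h r hr hrn hdr)
      simp only [hermitianProduct, map_sum, map_mul, Complex.conj_conj, map_ratCast,
        map_zero] at h1
      rw [sum_residueClass_mul_rootVector_of_dvd hd hdr, h1, mul_zero]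
    · exact sum_residueClass_mul_rootVector_of_not_dvd hd hdr _
  have := congrFun h0 i
  simp only [Pi.zero_apply] at this
  exact_mod_cast this

/-- The sums over a union of residue classes vanish when those over the classes do. -/
theorem sum_filter_eq_zero {d : ℕ} (hd : d ∣ n) {v : Fin n → ℚ}
    (h : ∀ i, ∑ j ∈ residueClass d i, v j = 0) (p : Fin n → Prop) [DecidablePred p]
    (hp : ∀ i j : Fin n, (i : ℕ) ≡ j [MOD d] → p i → p j) :
    ∑ j with p j, v j = 0 := by
  have hd0 : 0 < d := Nat.pos_of_dvd_of_pos hd (Nat.pos_of_neZero n)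
  have hm : 0 < n / d := Nat.div_pos (Nat.le_of_dvd (Nat.pos_of_neZero n) hd) hd0
  -- Double counting: each `j` with `p j` lies in the classes of exactly `n / d` indices `i`, all
  -- satisfying `p`.
  have h1 : ∑ i with p i, ∑ j ∈ residueClass d i, v j = (n / d : ℕ) * ∑ j with p j, v j := by
    rw [Finset.sum_comm' (t' := Finset.univ.filter p) (s' := fun j => residueClass d j),
      Finset.mul_sum]
    · refine Finset.sum_congr rfl fun j _ => ?_
      rw [Finset.sum_const, card_residueClass hd, nsmul_eq_mul]
    · intro i j
      simp only [Finset.mem_filter, Finset.mem_univ, true_and, mem_residueClass]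
      exact ⟨fun ⟨hi, hj⟩ => ⟨hj.symm, hp i j hj.symm hi⟩, fun ⟨hi, hj⟩ => ⟨hp j i hi.symm hj, hi.symm⟩⟩
  rw [Finset.sum_eq_zero fun i _ => h i] at h1
  have hm' : ((n / d : ℕ) : ℚ) ≠ 0 := by exact_mod_cast hm.ne'
  exact (mul_eq_zero.1 h1.symm).resolve_left hm'

end Fourier

/-! ### Analytic continuation of the relation along loops. -/

/-- A linear relation between the values of a polynomial on the branches of `P⁻¹` persists under
the action of the monodromy group. -/
theorem sum_monodromy_eq_zero {P : ℂ[X]} {n : ℕ} (hn : 1 ≤ n) {U : Set ℂ} {φ : Fin n → ℂ → ℂ}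
    (hφ : IsBranchSystem P U φ) {z₀ : ℂ} (hz₀ : z₀ ∈ U) {v : Fin n → ℂ} {Q : ℂ[X]}
    (h : ∀ z ∈ U, ∑ i, v i * Q.eval (φ i z) = 0) {σ : Equiv.Perm (Fin n)}
    (hσ : σ ∈ monodromyGroup P (hφ.notMem_criticalValues z₀ hz₀) (fun i => φ i z₀)
      (fun i => hφ.eval_eq i z₀ hz₀)) :
    ∀ z ∈ U, ∑ i, v i * Q.eval (φ (σ i) z) = 0 := by
  have hP := hφ.natDegree_eq
  have hfin : (criticalValues P).Finite := criticalValues_finite (hP ▸ hn)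
  obtain ⟨γ, hγ, hlift⟩ := hσ
  choose c hc using hlift
  -- Identity theorem: the relation for germs at one point of `B` spreads over all of `B` for the
  -- sheets they belong to.
  have hrel : ∀ {B : Set ℂ}, IsOpen B → IsPreconnected B → ∀ {ψ : Fin n → ℂ → ℂ},
      (∀ i, DifferentiableOn ℂ (ψ i) B) → (∀ i, ∀ w ∈ B, P.eval (ψ i w) = w) →
      (∀ w ∈ B, Function.Injective fun i => ψ i w) → ∀ (τ : Fin n → Fin n) {a : ℂ}, a ∈ B →
      ∀ {χ : Fin n → ℂ → ℂ}, (∀ i, ContinuousAt (χ i) a ∧ χ i a = ψ (τ i) a ∧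
        ∀ᶠ w in 𝓝 a, P.eval (χ i w) = w) → (∀ᶠ w in 𝓝 a, ∑ i, v i * Q.eval (χ i w) = 0) →
      ∀ w ∈ B, ∑ i, v i * Q.eval (ψ (τ i) w) = 0 := by
    intro B hB hBc ψ hdiff hev hinj τ a ha χ hχ hsum
    have hdiffs : DifferentiableOn ℂ (fun w => ∑ i, v i * Q.eval (ψ (τ i) w)) B :=
      DifferentiableOn.fun_sum fun i _ =>
        (Q.differentiable.comp_differentiableOn (hdiff (τ i))).const_mul _
    have heq : ∀ᶠ w in 𝓝 a, ∀ i, χ i w = ψ (τ i) w := by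
      rw [eventually_all]
      intro i
      exact eventually_eq_branch (f := fun w => w) hn hP hB (fun i => (hdiff i).continuousOn) hev
        hinj continuousAt_id (hχ i).1 (hχ i).2.2 ha (hχ i).2.1
    have hz : (fun w => ∑ i, v i * Q.eval (ψ (τ i) w)) =ᶠ[𝓝 a] fun _ => 0 := by
      filter_upwards [heq, hsum] with w hw hs
      simpa only [hw] using hs
    exact (hdiffs.analyticOnNhd hB).eqOn_zero_of_preconnected_of_eventuallyEq_zero hBc ha hz
  -- `K t` says that the relation holds near `γ t` for the germs of inverse branches through the
  -- lifted points `c i t`. It is locally constant in `t`, hence passes from `0` to `1`, where `c i`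
  -- ends at `φ (σ i) z₀`.
  let K : unitInterval → Prop := fun t => ∃ χ : Fin n → ℂ → ℂ,
    (∀ i, ContinuousAt (χ i) (γ t) ∧ χ i (γ t) = c i t ∧
      ∀ᶠ w in 𝓝 (γ t), P.eval (χ i w) = w) ∧ ∀ᶠ w in 𝓝 (γ t), ∑ i, v i * Q.eval (χ i w) = 0
  have hK : IsLocallyConstant K := by
    rw [IsLocallyConstant.iff_eventually_eq]
    intro t₀
    have hcrit : γ t₀ ∉ criticalValues P := hγ t₀
    obtain ⟨y, hy, hyz⟩ := exists_fibre hn hP hcrit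
    obtain ⟨r, hr, ψ, hψ, -, hdiff, hev, hinj⟩ := exists_sheets hcrit hfin hy hyz
    have hmem := Metric.mem_ball_self (x := γ t₀) hr
    have hτ : ∀ i, ∃ j, ψ j (γ t₀) = c i t₀ := fun i =>
      exists_eq_of_eval_eq hn hP (hinj _ hmem) (fun j => hev j _ hmem) (hc i t₀)
    choose τ hτ using hτ
    have hcont : ∀ᶠ t in 𝓝 t₀, ∀ i, c i t = ψ (τ i) (γ t) := by
      rw [eventually_all]
      intro i
      exact eventually_eq_branch (f := γ) (u := c i) hn hP Metric.isOpen_ball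
        (fun i => (hdiff i).continuousOn) hev hinj γ.continuous.continuousAt
        (c i).continuous.continuousAt (.of_forall (hc i)) hmem (hτ i).symm
    have hball : ∀ᶠ t in 𝓝 t₀, γ t ∈ Metric.ball (γ t₀) r :=
      γ.continuous.continuousAt.eventually_mem (Metric.ball_mem_nhds _ hr)
    have key : ∀ᶠ t in 𝓝 t₀, (K t ↔
        ∀ w ∈ Metric.ball (γ t₀) r, ∑ i, v i * Q.eval (ψ (τ i) w) = 0) := by
      filter_upwards [hcont, hball] with t ht htb
      constructor
      · rintro ⟨χ, hχ, hs⟩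
        exact hrel Metric.isOpen_ball (convex_ball _ _).isPreconnected hdiff hev hinj τ htb
          (fun i => ⟨(hχ i).1, (hχ i).2.1.trans (ht i), (hχ i).2.2⟩) hs
      · intro hs
        have hnhds := Metric.isOpen_ball.mem_nhds htb
        exact ⟨fun i => ψ (τ i), fun i => ⟨(hdiff (τ i)).continuousOn.continuousAt hnhds,
          (ht i).symm, Filter.mem_of_superset hnhds fun w hw => hev (τ i) w hw⟩,
          Filter.mem_of_superset hnhds fun w hw => hs w hw⟩
    filter_upwards [key] with t ht
    exact propext (ht.trans key.self_of_nhds.symm)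
  have hU := hφ.isOpen.mem_nhds hz₀
  have h0 : K 0 := by
    refine ⟨φ, fun i => ⟨?_, ?_, ?_⟩, ?_⟩
    · rw [γ.source]
      exact (hφ.differentiableOn i).continuousOn.continuousAt hU
    · rw [γ.source, (c i).source]
    · rw [γ.source]
      exact Filter.mem_of_superset hU fun w hw => hφ.eval_eq i w hw
    · rw [γ.source]
      exact Filter.mem_of_superset hU fun w hw => h w hw
  have h1 : K 1 := by
    rw [← hK.apply_eq_of_preconnectedSpace 0 1]
    exact h0
  obtain ⟨χ, hχ, hs⟩ := h1
  rw [γ.target] at hs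
  refine hrel hφ.isOpen hφ.isConnected.isPreconnected hφ.differentiableOn hφ.eval_eq hφ.injective
    σ hz₀ (fun i => ?_) hs
  have := hχ i
  rwa [γ.target, (c i).target] at this

theorem isTransport_of_isBranchSystem {P : ℂ[X]} {n : ℕ} {U : Set ℂ} {φ : Fin n → ℂ → ℂ}
    (hφ : IsBranchSystem P U φ) {z₀ z : ℂ} (hz₀ : z₀ ∈ U) (hz : z ∈ U) :
    IsTransport P z₀ (fun i => φ i z₀) z fun i => φ i z :=
  IsTransport.along_branches hφ.notMem_criticalValues
    (fun i => (hφ.differentiableOn i).continuousOn) hφ.eval_eq hφ.injective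
    ((hφ.isOpen.isConnected_iff_isPathConnected.1 hφ.isConnected).joinedIn _ hz₀ _ hz)
    (IsTransport.refl (hφ.notMem_criticalValues _ hz₀) (hφ.injective _ hz₀)
      fun i => hφ.eval_eq i _ hz₀)

theorem IsLoopAroundInfinity.avoidsCriticalValues {P : ℂ[X]} {z₀ : ℂ} {γ : Path z₀ z₀}
    (h : IsLoopAroundInfinity P γ) : AvoidsCriticalValues P γ := by
  obtain ⟨R, hR, hlt, α, hα, hγ⟩ := h
  have hcirc : ∀ t, circlePath R t ∉ criticalValues P := by
    intro t ht
    have h1 := hlt _ ht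
    have h2 : ‖circlePath R t‖ = R := by
      change ‖(R : ℂ) * Complex.exp (2 * Real.pi * Complex.I * ((t : ℝ) : ℂ))‖ = R
      rw [norm_mul, show (2 * Real.pi * Complex.I * ((t : ℝ) : ℂ) : ℂ) =
        ((2 * Real.pi * (t : ℝ) : ℝ) : ℂ) * Complex.I by push_cast; ring,
        Complex.norm_exp_ofReal_mul_I]
      simp [abs_of_pos hR]
    linarith
  intro t
  rcases hγ with rfl | rfl <;> simp only [Path.trans_apply] <;> split_ifs
  all_goals first | exact hα _ | exact hcirc _

/-! ### Cyclic shifts, cycles, and removal of Fourier coefficients. -/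

theorem finRotate_pow_apply {n : ℕ} [NeZero n] (s i : Fin n) :
    (finRotate n ^ (s : ℕ)) i = i + s := by
  obtain ⟨m, rfl⟩ : ∃ m, n = m + 1 := ⟨n - 1, by have := Nat.pos_of_neZero n; omega⟩
  have key : ∀ k : ℕ, (finRotate (m + 1) ^ k) i = i + Fin.ofNat (m + 1) k := by
    intro k
    induction k with
    | zero => simp
    | succ k ih =>
      rw [pow_succ', Equiv.Perm.mul_apply, ih, finRotate_apply]
      ext
      simp [Fin.val_add, add_assoc]
  rw [key]
  simp

theorem integralOver_cycleAt {n : ℕ} (φ : Fin n → ℂ → ℂ) (δ : Fin n → ℚ) (z : ℂ) (Q : ℂ[X]) :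
    integralOver (cycleAt φ δ z) Q = ∑ i, (δ i : ℂ) * Q.eval (φ i z) := by
  rw [integralOver, cycleAt, ← Finsupp.sum_finsetSum_index]
  · simp
  · simp
  · intro a b c
    push_cast
    ring

open Classical in
theorem isReduced_inducedCycle_iff {n : ℕ} (φ : Fin n → ℂ → ℂ) (δ : Fin n → ℚ) (z w : ℂ)
    (W : ℂ[X]) : IsReduced (inducedCycle W (cycleAt φ δ z) w) ↔
      ∑ i with W.eval (φ i z) = w, δ i = 0 := by
  have h1 : inducedCycle W (cycleAt φ δ z) w =
      ∑ i, if W.eval (φ i z) = w then Finsupp.single (φ i z) (δ i) else 0 := by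
    rw [inducedCycle, cycleAt, Finsupp.filter_sum]
    refine Finset.sum_congr rfl fun i _ => ?_
    split_ifs with h
    · exact Finsupp.filter_single_of_pos _ h
    · exact Finsupp.filter_single_of_neg _ h
  rw [IsReduced, h1, ← Finset.sum_filter, ← Finsupp.sum_finsetSum_index]
  · simp
  · simp
  · simp

/-- A polynomial vanishing on a branch over a nonempty open set is zero. -/
theorem eq_zero_of_eval_branch {P : ℂ[X]} {n : ℕ} {U : Set ℂ} {φ : Fin n → ℂ → ℂ}
    (hφ : IsBranchSystem P U φ) {R : ℂ[X]} (i : Fin n) (h : ∀ z ∈ U, R.eval (φ i z) = 0) :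
    R = 0 := by
  obtain ⟨z, hz⟩ := hφ.isConnected.nonempty
  have hU : U.Infinite := infinite_of_mem_nhds z (hφ.isOpen.mem_nhds hz)
  have hinj : Set.InjOn (φ i) U := fun a ha b hb hab => by
    rw [← hφ.eval_eq i a ha, hab, hφ.eval_eq i b hb]
  refine eq_zero_of_infinite_isRoot R ((hU.image hinj).mono ?_)
  rintro _ ⟨a, ha, rfl⟩
  exact h a ha

/-- Successively subtracting averages over blocks removes all Fourier coefficients whose index is
divisible by one of the `n / d i`. -/
theorem exists_decomposition {n l : ℕ} [NeZero n] {U : Set ℂ} {φ : Fin n → ℂ → ℂ} {d : Fin l → ℕ}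
    (hd : ∀ i, d i ∣ n) (W : Fin l → ℂ[X])
    (hW : ∀ i (g : ℂ[X]), ∃ S : ℂ[X], ∀ z ∈ U, ∀ j,
      (S.comp (W i)).eval (φ j z) = ∑ k ∈ residueClass (d i) j, g.eval (φ k z))
    {v : Fin n → ℂ} {Q : ℂ[X]}
    (hQ : ∀ z ∈ U, ∀ s, ∑ j, v j * Q.eval (φ (j + s) z) = 0) (t : Finset (Fin l)) :
    ∃ (R : ℂ[X]) (S : Fin l → ℂ[X]), Q = R + ∑ i ∈ t, (S i).comp (W i) ∧ ∀ z ∈ U,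
      (∀ s, ∑ j, v j * R.eval (φ (j + s) z) = 0) ∧
      ∀ i ∈ t, ∀ r, n / d i ∣ r → ∑ j, R.eval (φ j z) * rootVector n r j = 0 := by
  classical
  have hn := Nat.pos_of_neZero n
  induction t using Finset.induction_on with
  | empty => exact ⟨Q, 0, by simp, fun z hz => ⟨hQ z hz, by simp⟩⟩
  | insert a t ha ih =>
    obtain ⟨R, S, hRS, hR⟩ := ih
    obtain ⟨T, hT⟩ := hW a R
    have hm : ((n / d a : ℕ) : ℂ) ≠ 0 := by
      exact_mod_cast (Nat.div_pos (Nat.le_of_dvd hn (hd a))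
        (Nat.pos_of_dvd_of_pos (hd a) hn)).ne'
    set c : ℂ := ((n / d a : ℕ) : ℂ)⁻¹ with hc
    -- On the fibres `T'` is the average of `R` over blocks mod `d a`.
    set T' : ℂ[X] := (C c * T).comp (W a) with hT'
    have hTe : ∀ z ∈ U, ∀ j, T'.eval (φ j z) =
        c * ∑ k ∈ residueClass (d a) j, R.eval (φ k z) := fun z hz j => by
      rw [← hT z hz j, hT', mul_comp, C_comp, eval_mul, eval_C]
    refine ⟨R - T', Function.update S a (C c * T), ?_, fun z hz => ⟨fun s => ?_, ?_⟩⟩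
    · rw [Finset.sum_insert ha, Function.update_self, ← hT', hRS]
      have h1 : ∑ i ∈ t, (Function.update S a (C c * T) i).comp (W i) =
          ∑ i ∈ t, (S i).comp (W i) := Finset.sum_congr rfl fun i hi => by
        rw [Function.update_of_ne (ne_of_mem_of_not_mem hi ha)]
      rw [h1]
      ring
    · have h1 : ∑ j, v j * T'.eval (φ (j + s) z) = 0 := by
        have h2 : ∑ j, v j * ∑ k ∈ residueClass (d a) (j + s), R.eval (φ k z) = 0 := by
          simp_rw [sum_residueClass (hd a), Finset.mul_sum]
          rw [Finset.sum_comm]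
          refine Finset.sum_eq_zero fun k _ => ?_
          rw [← (hR z hz).1 (s + Fin.ofNat n (d a * k))]
          simp_rw [add_assoc]
        calc _ = c * ∑ j, v j * ∑ k ∈ residueClass (d a) (j + s), R.eval (φ k z) := by
              rw [Finset.mul_sum]
              refine Finset.sum_congr rfl fun j _ => ?_
              rw [hTe z hz]
              ring
          _ = 0 := by rw [h2, mul_zero]
      simp only [eval_sub, mul_sub, Finset.sum_sub_distrib, h1, (hR z hz).1 s, sub_zero]
    · intro i hi r hr
      have h1 : ∑ j, T'.eval (φ j z) * rootVector n r j =
          c * ∑ j, (∑ k ∈ residueClass (d a) j, R.eval (φ k z)) * rootVector n r j := by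
        rw [Finset.mul_sum]
        refine Finset.sum_congr rfl fun j _ => ?_
        rw [hTe z hz]
        ring
      simp only [eval_sub, sub_mul, Finset.sum_sub_distrib, h1]
      -- For the new index averaging preserves the coefficient, so it cancels in `R - T'`. For an
      -- old one the coefficient of `T'` is a multiple of that of `R`, already zero.
      rcases Finset.mem_insert.1 hi with rfl | hi
      · rw [sum_residueClass_mul_rootVector_of_dvd (hd i) hr fun k => R.eval (φ k z), hc,
          inv_mul_cancel_left₀ hm, sub_self]
      · rw [sum_residueClass_mul_rootVector (hd a) fun k => R.eval (φ k z),
          (hR z hz).2 i hi r hr]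
        simp

end ZeroDimAbelian

/-! ### The proposition. -/

open ZeroDimAbelian in
/-- `P` has degree `n ≥ 1`, `φ` are the branches of `P⁻¹` on a domain `U`, numbered so that a loop
around infinity acts on them as the cycle `(1 2 … n)`. -/
theorem propositionp4 (n : ℕ) (hn : 1 ≤ n) (P : ℂ[X]) (U : Set ℂ) (φ : Fin n → ℂ → ℂ)
    (hφ : IsBranchSystem P U φ) (z₀ : ℂ) (hz₀ : z₀ ∈ U)
    (hnum : ∃ γ : Path z₀ z₀, IsLoopAroundInfinity P γ ∧
      IsMonodromyAlong P (fun i => φ i z₀) γ (finRotate n))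
    (δ : Fin n → ℚ) (Q : ℂ[X]) (hQ : Q ≠ 0)
    (hint : ∀ z ∈ U, integralOver (cycleAt φ δ z) Q = 0)
    (l : ℕ) (d : Fin l → ℕ)
    (hd : ∀ i, d i ∈ invariantDivisors (monodromyGroup P (hφ.notMem_criticalValues z₀ hz₀)
      (fun i => φ i z₀) (fun i => hφ.eval_eq i z₀ hz₀)))
    (hδ : ∀ r : ℕ, 1 ≤ r → r ≤ n →
      (hermitianProduct (fun j => (δ j : ℂ)) (rootVector n r) = 0 ↔ ∃ i, n / d i ∣ r)) :
    ∃ (m : ℕ) (A W S : Fin m → ℂ[X]),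
      (∀ i, P = (A i).comp (W i)) ∧
      Q = ∑ i, (S i).comp (W i) ∧
      ∀ i, ∀ z ∈ U, ∀ w, (A i).eval w = z →
        IsReduced (inducedCycle (W i) (cycleAt φ δ z) w) := by
  classical
  have : NeZero n := ⟨by omega⟩
  have hP := hφ.natDegree_eq
  have hcrit := hφ.notMem_criticalValues z₀ hz₀
  have hx := hφ.injective z₀ hz₀
  have hxz := fun i => hφ.eval_eq i z₀ hz₀
  have htr : ∀ z ∈ U, IsTransport P z₀ (fun i => φ i z₀) z fun i => φ i z :=
    fun z hz => isTransport_of_isBranchSystem hφ hz₀ hz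
  obtain ⟨γ, hγ, hmon⟩ := hnum
  simp only [integralOver_cycleAt] at hint
  have hrot : ∀ z ∈ U, ∀ s, ∑ j, (δ j : ℂ) * Q.eval (φ (j + s) z) = 0 := fun z hz s => by
    have hmem : finRotate n ∈ monodromyGroup P hcrit (fun i => φ i z₀) hxz :=
      ⟨γ, hγ.avoidsCriticalValues, hmon⟩
    have h1 := sum_monodromy_eq_zero hn hφ hz₀ hint (Subgroup.pow_mem _ hmem (s : ℕ)) z hz
    simpa only [finRotate_pow_apply] using h1
  choose W hWdeg hWc using fun i => exists_blockProd hn hP hcrit hx hxz (hd i)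
  have hcomp := fun i (g : ℂ[X]) => exists_comp_of_blockConst (g := g) hn hP hcrit hx hxz (hd i)
    (hWdeg i) (hWc i) Set.finite_empty
  choose A hA using fun i => hcomp i P fun z _ y hy j k _ => by rw [hy.eval_eq, hy.eval_eq]
  have hW : ∀ i (g : ℂ[X]), ∃ S : ℂ[X], ∀ z ∈ U, ∀ j,
      (S.comp (W i)).eval (φ j z) = ∑ k ∈ residueClass (d i) j, g.eval (φ k z) := by
    intro i g
    obtain ⟨p, hp⟩ := exists_blockSum hn hP hcrit hx hxz (hd i) g
    obtain ⟨S, rfl⟩ := hcomp i p fun z _ y hy j k hjk => by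
      rw [hp z y hy, hp z y hy, residueClass_eq hjk]
    exact ⟨S, fun z hz j => hp z _ (htr z hz) j⟩
  obtain ⟨R, S, hRS, hR⟩ := exists_decomposition (fun i => (hd i).1) W hW hrot Finset.univ
  have hR0 : R = 0 := by
    refine eq_zero_of_eval_branch hφ ⟨0, hn⟩ fun z hz => ?_
    have h0 : (fun j => R.eval (φ j z)) = 0 := by
      refine eq_zero_of_sum_mul_rootVector fun r hr hrn => ?_
      -- Coefficients with `n / d i ∣ r` were removed by averaging; for the others `(δ, w_r) ≠ 0`,
      -- and the convolution identity forces them to vanish.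
      by_cases hex : ∃ i, n / d i ∣ r
      · obtain ⟨i, hi⟩ := hex
        exact (hR z hz).2 i (Finset.mem_univ i) r hi
      · exact (mul_eq_zero.1 (hermitianProduct_mul_sum_eq_zero
          (q := fun j => R.eval (φ j z)) (hR z hz).1 r)).resolve_left
            fun h => hex ((hδ r hr hrn).1 h)
    exact congrFun h0 _
  refine ⟨l, A, W, S, hA, by rw [hRS, hR0, zero_add], fun i z hz w _ => ?_⟩
  rw [isReduced_inducedCycle_iff]
  -- The indices over `w` form a union of residue classes mod `d i`, as `W i` is constant on blocks,
  -- and `δ` sums to zero on each class.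
  refine sum_filter_eq_zero (hd i).1 (sum_residueClass_eq_zero (hd i).1 fun r hr hrn hdr =>
    (hδ r hr hrn).2 ⟨i, hdr⟩) _ fun j k hjk h => ?_
  rw [← h]
  exact (hWc i z _ (htr z hz) j k hjk).symm
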